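/- Let $p$ be a prime. A graph $X$ (in Serre's sense) has a set $VX$ of vertices and a set $EX$ of edges; each edge $y$ has an origin $o(y)$, a terminus $t(y)$ and an opposite edge $\bar y\neq y$, with $\bar{\bar y}=y$ and $o(\bar y)=t(y)$. A graph of groups $(X,G_\bullet)$ consists of a connected (possibly infinite) graph $X$, a group $G_x$ for each $x\in VX\sqcup EX$ with $G_y=G_{\bar y}$ for $y\in EX$, and monomorphisms $f_y\colon G_y\hookrightarrow G_{t(y)}$ for $y\in EX$. Fix a maximal subtree $T$ of $X$ and an orientation, that is, a subset $E^+X\subseteq EX$ containing exactly one of $y,\bar y$ for each $y\in EX$; put $\epsilon(y)=0$ if $y\in E^+X$ and $\epsilon(y)=1$ otherwise. The fundamental group $\pi_1(X,G_\bullet)$ is the quotient of the free product of all the groups $G_x$ (one factor for each vertex, and one for each pair $\{y,\bar y\}$ of opposite edges) and the free group on letters $s_y$ ($y\in EX$) by the relations $g=s_y^{1-\epsilon(y)}f_y(g)s_y^{\epsilon(y)-1}$ for $y\in EX$, $g\in G_y$; $s_y=1$ for every edge $y$ of $T$; and $s_{\bar y}=s_y$ for $y\in EX$. A chief series of a finite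 $p$-group $P$ is a sequence $P=P^{(0)}\ge P^{(1)}\ge\cdots$ of normal subgroups of $P$ such that each factor $\gamma^{(k)}(P)=P^{(k)}/P^{(k+1)}$ is trivial or of order $p$, and such that $P^{(n)}=1$ for some $n$. A group $G$ is residually $p$-finite if for every $g\in G\smallsetminus\{1\}$ there is a normal subgroup of $G$, of index a power of $p$, that does not contain $g$. **Theorem.** Let $(X,G_\bullet)$ be a graph of finite $p$-groups, where $X$ may be infinite. Suppose that there is a chief series $(G_x^{(k)})_{k\ge 0}$ of $G_x$ for each $x\in VX\sqcup EX$, with $G_{\bar y}^{(k)}=G_y^{(k)}$ for $y\in EX$, such that the following two properties hold. (I) For all $k\ge 0$ and all $y\in EX$, $f_y(G_y^{(k)})=f_y(G_y)\cap G_{t(y)}^{(k)}$. (II) For each $k\ge 0$ there is a family of injective homomorphisms $\phi_x^{(k)}\colon\gamma^{(k)}(G_x)\hookrightarrow\mathbb{F}_p$ ($x\in VX\sqcup EX$), into the additive group of $\mathbb{F}_p$, with $\phi_{\bar y}^{(k)}=\phi_y^{(k)}$ for $y\in EX$, such that $\phi_{t(y)}^{(k)}\circ \bar f_y=\phi_y^{(k)}$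 for all $y\in EX$, where $\bar f_y\colon\gamma^{(k)}(G_y)\to\gamma^{(k)}(G_{t(y)})$ is induced by $f_y$. Then $\pi_1(X,G_\bullet)$ (for any choice of $T$ and $E^+X$) is residually $p$-finite. -/

import Mathlib

universe u v w w'

/-- A graph in the sense of Serre, with vertex set `V` and edge set `E`: every edge `y` has an
origin `o y`, a terminus `t y` and an opposite edge `bar y`, different from `y`. -/
structure SerreGraph (V : Type u) (E : Type v) where
  o : E → V
  t : E → V
  bar : E → E
  bar_bar : ∀ y, bar (bar y) = y
  bar_ne : ∀ y, bar y ≠ y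
  o_bar : ∀ y, o (bar y) = t y

namespace SerreGraph

variable {V : Type u} {E : Type v} (X : SerreGraph V E)

/-- `X.IsPath a l b`: the list `l` of edges is an edge path from `a` to `b`. -/
def IsPath : V → List E → V → Prop
  | a, [], b => a = b
  | a, y :: l, b => X.o y = a ∧ IsPath (X.t y) l b

/-- An edge path is reduced if it never traverses an edge and then immediately its opposite. -/
def IsReduced (l : List E) : Prop :=
  l.IsChain (fun y z => z ≠ X.bar y)

/-- A connected graph is nonempty and any two of its vertices are joined by an edge path. -/
def IsConnected : Prop :=
  Nonempty V ∧ ∀ a b : V, ∃ l : List E, X.IsPath a l b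

/-- Two edges are identified if they are equal or opposite. -/
def geomSetoid : Setoid E where
  r y z := z = y ∨ z = X.bar y
  iseqv :=
    { refl := fun _ => Or.inl rfl
      symm := by
        rintro y z (rfl | rfl)
        · exact Or.inl rfl
        · exact Or.inr (X.bar_bar y).symm
      trans := by
        rintro x y z (rfl | rfl) (rfl | rfl)
        · exact Or.inl rfl
        · exact Or.inr rfl
        · exact Or.inr rfl
        · exact Or.inl (X.bar_bar x) }

/-- Geometric edges: pairs `{y, bar y}` of opposite edges. -/
def GeomEdge : Type v := Quotient X.geomSetoid

/-- The geometric edge underlying `y`. -/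
def geom (y : E) : X.GeomEdge := Quotient.mk X.geomSetoid y

theorem geom_bar (y : E) : X.geom (X.bar y) = X.geom y :=
  (Quotient.sound (s := X.geomSetoid) (Or.inr rfl)).symm

/-- A subgraph of `X`. (Closure of the edge set under `bar` makes it contain the termini of its
edges as well.) -/
@[ext]
structure Sub where
  verts : Set V
  edges : Set E
  bar_mem : ∀ y ∈ edges, X.bar y ∈ edges
  o_mem : ∀ y ∈ edges, X.o y ∈ verts

variable {X}

/-- A subgraph is a tree if it is nonempty, connected, and contains no nontrivial reduced closed
edge path. -/
structure Sub.IsTree (T : X.Sub) : Prop where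
  nonempty : T.verts.Nonempty
  connected : ∀ a ∈ T.verts, ∀ b ∈ T.verts,
    ∃ l : List E, (∀ y ∈ l, y ∈ T.edges) ∧ X.IsPath a l b
  acyclic : ∀ (a : V) (l : List E), (∀ y ∈ l, y ∈ T.edges) → X.IsPath a l a →
    X.IsReduced l → l = []

/-- A maximal subtree: a subtree that is maximal, under inclusion, among all subtrees. -/
def Sub.IsMaximalSubtree (T : X.Sub) : Prop :=
  T.IsTree ∧ ∀ T' : X.Sub, T'.IsTree → T.verts ⊆ T'.verts → T.edges ⊆ T'.edges → T' = T

variable (X)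

/-- An orientation: a set of edges containing exactly one of `y` and `bar y`, for every `y`. -/
def IsOrientation (P : Set E) : Prop :=
  ∀ y : E, Xor (y ∈ P) (X.bar y ∈ P)

end SerreGraph

open Classical in
/-- The function `ε` attached to an orientation: `0` on positive edges, `1` on the others. -/
noncomputable def edgeSign {E : Type v} (P : Set E) (y : E) : ℤ :=
  if y ∈ P then 0 else 1

/-- A graph of groups over `X`: `X` is connected, each vertex `a` carries a group `vertexGroup a`,
each pair of opposite edges carries a single group (so that `y` and `bar y` have the same edge
group), and for each edge `y` there is a monomorphism from its group to that of `t y`. -/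
structure GraphOfGroups {V : Type u} {E : Type v} (X : SerreGraph V E) where
  connected : X.IsConnected
  vertexGroup : V → Type w
  edgeGroup : X.GeomEdge → Type w'
  [vertexInst : ∀ a, Group (vertexGroup a)]
  [edgeInst : ∀ e, Group (edgeGroup e)]
  f : ∀ y : E, edgeGroup (X.geom y) →* vertexGroup (X.t y)
  f_injective : ∀ y, Function.Injective (f y)

attribute [instance] GraphOfGroups.vertexInst GraphOfGroups.edgeInst

namespace GraphOfGroups

variable {V : Type u} {E : Type v} {X : SerreGraph V E} (𝒢 : GraphOfGroups.{u, v, w, w'} X)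

/-- The free product of all vertex groups, all edge groups, and the free group on the letters
`s_y`, for `y` an edge. -/
def PreGroup : Type _ :=
  Monoid.Coprod (Monoid.CoprodI 𝒢.vertexGroup)
    (Monoid.Coprod (Monoid.CoprodI 𝒢.edgeGroup) (FreeGroup E))

instance : Group 𝒢.PreGroup :=
  inferInstanceAs (Group (Monoid.Coprod (Monoid.CoprodI 𝒢.vertexGroup)
    (Monoid.Coprod (Monoid.CoprodI 𝒢.edgeGroup) (FreeGroup E))))

/-- The inclusion of a vertex group in the free product. -/
def ofVertex (a : V) : 𝒢.vertexGroup a →* 𝒢.PreGroup :=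
  Monoid.Coprod.inl.comp Monoid.CoprodI.of

/-- The inclusion of an edge group in the free product. -/
def ofEdge (e : X.GeomEdge) : 𝒢.edgeGroup e →* 𝒢.PreGroup :=
  Monoid.Coprod.inr.comp (Monoid.Coprod.inl.comp Monoid.CoprodI.of)

/-- The letter `s_y` in the free product. -/
def letter (y : E) : 𝒢.PreGroup :=
  Monoid.Coprod.inr (Monoid.Coprod.inr (FreeGroup.of y))

/-- The relations `left = right` of the fundamental group, for the subtree `T` and the
orientation `P`. -/
inductive Relation (T : X.Sub) (P : Set E) : 𝒢.PreGroup → 𝒢.PreGroup → Prop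
  | edge (y : E) (g : 𝒢.edgeGroup (X.geom y)) :
      Relation T P (𝒢.ofEdge (X.geom y) g)
        (𝒢.letter y ^ (1 - edgeSign P y) * 𝒢.ofVertex (X.t y) (𝒢.f y g) *
          𝒢.letter y ^ (edgeSign P y - 1))
  | tree (y : E) (hy : y ∈ T.edges) : Relation T P (𝒢.letter y) 1
  | bar (y : E) : Relation T P (𝒢.letter (X.bar y)) (𝒢.letter y)

/-- The relators `left * right⁻¹`. -/
def relators (T : X.Sub) (P : Set E) : Set 𝒢.PreGroup :=
  {r | ∃ a b, 𝒢.Relation T P a b ∧ r = a * b⁻¹}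

/-- The fundamental group of a graph of groups, for the subtree `T` and the orientation `P`. -/
abbrev FundamentalGroup (T : X.Sub) (P : Set E) : Type _ :=
  𝒢.PreGroup ⧸ Subgroup.normalClosure (𝒢.relators T P)

end GraphOfGroups

/-- A (non-terminating) chief series of a finite `p`-group `G`. -/
structure ChiefSeries (p : ℕ) (G : Type w) [Group G] where
  term : ℕ → Subgroup G
  term_zero : term 0 = ⊤
  term_succ_le : ∀ k, term (k + 1) ≤ term k
  normal : ∀ k, (term k).Normal
  card_factor : ∀ k,
    Nat.card (↥(term k) ⧸ (term (k + 1)).subgroupOf (term k)) = 1 ∨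
      Nat.card (↥(term k) ⧸ (term (k + 1)).subgroupOf (term k)) = p
  exists_eq_bot : ∃ n, term n = ⊥

attribute [instance] ChiefSeries.normal

namespace ChiefSeries

variable {p : ℕ} {G : Type w} [Group G] {H : Type w'} [Group H]

/-- The chief factor `γ⁽ᵏ⁾(G) = G⁽ᵏ⁾ / G⁽ᵏ⁺¹⁾`. -/
abbrev factor (C : ChiefSeries p G) (k : ℕ) : Type w :=
  ↥(C.term k) ⧸ (C.term (k + 1)).subgroupOf (C.term k)

/-- The map of chief factors induced by a homomorphism that respects the series. -/
def factorMap (C : ChiefSeries p G) (D : ChiefSeries p H) (f : G →* H)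
    (h : ∀ k, (C.term k).map f ≤ D.term k) (k : ℕ) : C.factor k →* D.factor k :=
  QuotientGroup.map _ _
    ((f.comp (C.term k).subtype).codRestrict (D.term k)
      fun x => h k (Subgroup.mem_map_of_mem f x.2))
    fun _ hx => Subgroup.mem_subgroupOf.2
      (h (k + 1) (Subgroup.mem_map_of_mem f (Subgroup.mem_subgroupOf.1 hx)))

end ChiefSeries

namespace GraphOfGroups

variable {V : Type u} {E : Type v} {X : SerreGraph V E} (𝒢 : GraphOfGroups.{u, v, w, w'} X)
  {p : ℕ}

/-- Compatibility of the edge maps with the chief series: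
`f_y (G_y⁽ᵏ⁾) = f_y (G_y) ∩ G_{t(y)}⁽ᵏ⁾`. -/
def SeriesCompatible (Cv : ∀ a, ChiefSeries p (𝒢.vertexGroup a))
    (Ce : ∀ e, ChiefSeries p (𝒢.edgeGroup e)) : Prop :=
  ∀ (k : ℕ) (y : E),
    ((Ce (X.geom y)).term k).map (𝒢.f y) = (𝒢.f y).range ⊓ (Cv (X.t y)).term k

variable {𝒢}

theorem SeriesCompatible.map_le {Cv : ∀ a, ChiefSeries p (𝒢.vertexGroup a)}
    {Ce : ∀ e, ChiefSeries p (𝒢.edgeGroup e)} (h : 𝒢.SeriesCompatible Cv Ce) (y : E) (k : ℕ) :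
    ((Ce (X.geom y)).term k).map (𝒢.f y) ≤ (Cv (X.t y)).term k :=
  (h k y).le.trans inf_le_right

/-- For each `k` there are injective homomorphisms from all the `k`-th chief factors to `𝔽_p`
that commute with the maps of chief factors induced by the edge maps. -/
def FactorsCompatible {Cv : ∀ a, ChiefSeries p (𝒢.vertexGroup a)}
    {Ce : ∀ e, ChiefSeries p (𝒢.edgeGroup e)} (h : 𝒢.SeriesCompatible Cv Ce) : Prop :=
  ∀ k : ℕ, ∃ (φv : ∀ a, (Cv a).factor k →* Multiplicative (ZMod p))
    (φe : ∀ e, (Ce e).factor k →* Multiplicative (ZMod p)),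
    (∀ a, Function.Injective (φv a)) ∧ (∀ e, Function.Injective (φe e)) ∧
    ∀ y : E, (φv (X.t y)).comp
      ((Ce (X.geom y)).factorMap (Cv (X.t y)) (𝒢.f y) (h.map_le y) k) = φe (X.geom y)

end GraphOfGroups

/-- `G` is residually `p`-finite: every nontrivial element is avoided by some normal subgroup of
index a power of `p`. -/
def ResiduallyPFinite (p : ℕ) (G : Type w) [Group G] : Prop :=
  ∀ g : G, g ≠ 1 → ∃ N : Subgroup G, N.Normal ∧ (∃ n : ℕ, N.index = p ^ n) ∧ g ∉ N

/-!
Bass–Serre theory writes every element of the fundamental group as a product of elements of vertex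
groups and edge elements along a closed path, and this word can be taken to be reduced
(`GraphOfGroups.exists_isReducedWord`). It therefore suffices to find, for each reduced word that
represents a nontrivial element, a homomorphism to a finite `p`-group that does not kill it.

The chief series enter through `GraphOfGroups.FactorsCompatible.nonempty_compatibleActions`: for
each `n` there is one finite `p`-group `P`, an iterated wreath product of copies of `𝔽_p`, acting on
a set, together with homomorphisms `τ a` from all vertex groups to `P` for which all point
stabilizers are the `n`-th terms of the chief series. In passing from `n` to `n + 1` one has to
extend the given homomorphism on the stabilizer, from the chief factor to `𝔽_p`, to a cocycle
(`exists_isActionCocycle`); this is possible because chief factors of `p`-groups are central.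
Cocycles with equal restrictions to stabilizers are cohomologous
(`IsActionCocycle.exists_coboundary`), so the two homomorphisms from an edge group to `P` through
its adjacent vertex groups stay conjugate, by some `c y`. These data already define a homomorphism
from the fundamental group to `P` (after conjugating along the maximal tree), whose restriction to a
vertex group has kernel contained in the `n`-th term of the series. A given word meets only finitely
many vertex groups, so for large `n` all of these embed into `P`, even if the graph is infinite and
the lengths of the series are unbounded.

To detect words of positive length, the conjugators are made generic. Let `P` act on the free group
with letters `(y, S)`, where `y` is an edge and `S ⊆ P`, by translating `S`. The letter
`e y = (y, B (bar y))`, with `B (bar y)` the image in `P` of the group of `y` at its origin,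
commutes with that image, so in the semidirect product `c y` may be replaced by `e y * c y * (e (bar y))⁻¹`.
The image of a reduced word then has as its free part a word of alternating signs in which adjacent
letters differ: a cancellation would mean a backtrack through the group of an edge
(`SerreGraph.isChain_freeLetters`). Such a word survives in a group of unitriangular matrices over
`𝔽_p` (`FreeGroup.exists_isPGroup_of_isChain`), and this finite `p`-quotient of the free group
induces one of the semidirect product, by a wreath product
(`SemidirectProduct.exists_isPGroup_of_left`).
-/

/-! ### Edge paths and maximal subtrees -/

namespace SerreGraph

variable {V : Type u} {E : Type v} {X : SerreGraph V E}

theorem t_bar (X : SerreGraph V E) (y : E) : X.t (X.bar y) = X.o y := by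
  rw [← X.o_bar, X.bar_bar]

theorem IsPath.append {a b c : V} {l m : List E} (hl : X.IsPath a l b) (hm : X.IsPath b m c) :
    X.IsPath a (l ++ m) c := by
  induction l generalizing a with
  | nil => cases hl; exact hm
  | cons y l ih => exact ⟨hl.1, ih hl.2⟩

theorem IsPath.of_append {a c : V} {l m : List E} (h : X.IsPath a (l ++ m) c) :
    ∃ b, X.IsPath a l b ∧ X.IsPath b m c := by
  induction l generalizing a with
  | nil => exact ⟨a, rfl, h⟩
  | cons y l ih =>
    obtain ⟨b, h₁, h₂⟩ := ih h.2
    exact ⟨b, ⟨h.1, h₁⟩, h₂⟩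

theorem IsPath.reverse {a b : V} {l : List E} (h : X.IsPath a l b) :
    X.IsPath b (l.map X.bar).reverse a := by
  induction l generalizing a with
  | nil => exact Eq.symm h
  | cons y l ih =>
    rw [List.map_cons, List.reverse_cons]
    exact (ih h.2).append ⟨X.o_bar y, (X.t_bar y).trans h.1⟩

section Potential

variable {Q : Type*} [Group Q] {C : E → Q}

/-- Closed edge paths in a tree have trivial holonomy, since they can be shortened by removing
backtracks. -/
theorem Sub.IsTree.prod_eq_one {T : X.Sub} (hT : T.IsTree)
    (hC : ∀ y, C (X.bar y) = (C y)⁻¹) (a : V) (l : List E) (hl : ∀ y ∈ l, y ∈ T.edges)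
    (h : X.IsPath a l a) : (l.map C).prod = 1 := by
  induction hn : l.length using Nat.strong_induction_on generalizing l with
  | _ n ih =>
    by_cases hr : X.IsReduced l
    · simp [hT.acyclic a l hl h hr]
    rw [IsReduced, List.isChain_iff_forall_rel_of_append_cons_cons] at hr
    push Not at hr
    obtain ⟨y, z, l₁, l₂, rfl, rfl⟩ := hr
    obtain ⟨b, h₁, h₂, -, h₃⟩ := h.of_append
    rw [X.t_bar, h₂] at h₃
    have := ih (l₁ ++ l₂).length (by simp at hn ⊢; omega) (l₁ ++ l₂)
      (fun y hy => hl y (by simp at hy ⊢; tauto)) (h₁.append h₃) rfl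
    simpa [hC] using this

/-- On a tree every cocycle with values in a group is the coboundary of a potential. -/
theorem Sub.IsTree.exists_potential {T : X.Sub} (hT : T.IsTree)
    (hC : ∀ y, C (X.bar y) = (C y)⁻¹) :
    ∃ f : V → Q, ∀ y ∈ T.edges, f (X.t y) = f (X.o y) * C y := by
  obtain ⟨b, hb⟩ := hT.nonempty
  have ht : ∀ y ∈ T.edges, X.t y ∈ T.verts := fun y hy => by
    rw [← X.o_bar]; exact T.o_mem _ (T.bar_mem y hy)
  choose l hl hp using hT.connected b hb
  classical
  refine ⟨fun a => if h : a ∈ T.verts then ((l a h).map C).prod else 1, fun y hy => ?_⟩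
  have ho := T.o_mem y hy
  simp only [ht y hy, ho, dif_pos]
  have h₁ := ((hp _ ho).append (show X.IsPath _ [y] (X.t y) from ⟨rfl, rfl⟩)).append
    (hp _ (ht y hy)).reverse
  have := hT.prod_eq_one hC b _ (fun z hz => ?_) h₁
  · have hinv : ∀ m : List E, ((m.map X.bar).reverse.map C).prod = ((m.map C).prod)⁻¹ := by
      intro m
      induction m with
      | nil => simp
      | cons z m ih =>
        rw [List.map_cons, List.reverse_cons, List.map_append, List.prod_append, ih]
        simp [hC]
    simp only [List.map_append, List.prod_append, hinv] at this
    simpa using (mul_inv_eq_one.1 this).symm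
  · simp only [List.mem_append, List.mem_reverse, List.mem_map, List.mem_singleton] at hz
    obtain (hz | rfl) | ⟨x, hx, rfl⟩ := hz
    · exact hl _ _ z hz
    · exact hy
    · exact T.bar_mem _ (hl _ _ x hx)

end Potential

/-- Attaching to a tree an edge that leaves its vertex set. -/
def Sub.attach (T : X.Sub) (y : E) (hy : X.o y ∈ T.verts) : X.Sub where
  verts := insert (X.t y) T.verts
  edges := insert y (insert (X.bar y) T.edges)
  bar_mem := by
    rintro z (rfl | rfl | hz)
    · exact Or.inr (Or.inl rfl)
    · exact Or.inl (X.bar_bar y)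
    · exact Or.inr (Or.inr (T.bar_mem z hz))
  o_mem := by
    rintro z (rfl | rfl | hz)
    · exact Or.inr hy
    · exact Or.inl (X.o_bar y)
    · exact Or.inr (T.o_mem z hz)

theorem Sub.IsTree.attach {T : X.Sub} (hT : T.IsTree) (y : E) (hy : X.o y ∈ T.verts)
    (hy' : X.t y ∉ T.verts) : (T.attach y hy).IsTree := by
  have hpath : ∀ a ∈ (T.attach y hy).verts, ∃ l : List E,
      (∀ z ∈ l, z ∈ (T.attach y hy).edges) ∧ X.IsPath a l (X.o y) := by
    rintro a (rfl | ha)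
    · exact ⟨[X.bar y], by simp [Sub.attach], X.o_bar y, X.t_bar y⟩
    · obtain ⟨l, hl, hp⟩ := hT.connected a ha _ hy
      exact ⟨l, fun z hz => Or.inr (Or.inr (hl z hz)), hp⟩
  -- `y` ends at a leaf, whose only outgoing edge is `bar y`
  have hout : ∀ z ∈ (T.attach y hy).edges, X.o z = X.t y → z = X.bar y := by
    rintro z (rfl | rfl | hz) h
    · exact absurd (h ▸ hy) hy'
    · rfl
    · exact absurd (h ▸ T.o_mem z hz) hy'
  -- hence a reduced path that starts elsewhere and traverses `y` stops there
  have hlast : ∀ (a b : V) (l : List E), (∀ z ∈ l, z ∈ (T.attach y hy).edges) →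
      X.IsPath a l b → X.IsReduced l → y ∈ l → b = X.t y := by
    intro a b l hl hp hr hyl
    obtain ⟨l₁, l₂, rfl⟩ := List.append_of_mem hyl
    obtain ⟨c, -, -, h₂⟩ := hp.of_append
    cases l₂ with
    | nil => exact Eq.symm h₂
    | cons z l₂ =>
      have hz := hout z (hl z (by simp)) h₂.1
      have := (List.isChain_append.1 hr).2.1
      exact absurd hz (List.isChain_cons_cons.1 this).1
  have hfirst : ∀ (a b : V) (l : List E), (∀ z ∈ l, z ∈ (T.attach y hy).edges) →
      X.IsPath a l b → X.IsReduced l → X.bar y ∈ l → a = X.t y := by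
    intro a b l hl hp hr hyl
    refine hlast b a (l.map X.bar).reverse ?_ hp.reverse ?_ ?_
    · intro z hz
      simp only [List.mem_reverse, List.mem_map] at hz
      obtain ⟨x, hx, rfl⟩ := hz
      exact (T.attach y hy).bar_mem _ (hl x hx)
    · rw [IsReduced, List.isChain_reverse, List.isChain_map]
      refine hr.imp fun x z hxz h => hxz ?_
      rw [X.bar_bar] at h
      exact h.symm
    · simp only [List.mem_reverse, List.mem_map]
      exact ⟨_, hyl, X.bar_bar y⟩
  have hin : ∀ (l : List E), (∀ z ∈ l, z ∈ (T.attach y hy).edges) → y ∉ l → X.bar y ∉ l →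
      ∀ z ∈ l, z ∈ T.edges := by
    intro l hl h₁ h₂ z hz
    rcases hl z hz with rfl | rfl | h
    · exact absurd hz h₁
    · exact absurd hz h₂
    · exact h
  refine ⟨⟨_, Or.inr hy⟩, fun a ha b hb => ?_, fun a l hl hp hr => ?_⟩
  · obtain ⟨l, hl, hlp⟩ := hpath a ha
    obtain ⟨m, hm, hmp⟩ := hpath b hb
    refine ⟨l ++ (m.map X.bar).reverse, fun z hz => ?_, hlp.append hmp.reverse⟩
    simp only [List.mem_append, List.mem_reverse, List.mem_map] at hz
    obtain hz | ⟨x, hx, rfl⟩ := hz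
    · exact hl z hz
    · exact (T.attach y hy).bar_mem _ (hm x hx)
  · by_cases ha : a = X.t y
    · subst ha
      cases l with
      | nil => rfl
      | cons z l =>
        obtain rfl := hout z (hl z (by simp)) hp.1
        exfalso
        have hl' : ∀ z ∈ l, z ∈ (T.attach y hy).edges := fun z hz => hl z (by simp [hz])
        have hr' : X.IsReduced l := List.IsChain.tail hr
        have hp' : X.IsPath (X.o y) l (X.t y) := X.t_bar y ▸ hp.2
        have hne : X.o y ≠ X.t y := fun h => hy' (h ▸ hy)
        have hyb : X.bar y ∉ l := fun h => hne (hfirst _ _ l hl' hp' hr' h)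
        rcases List.eq_nil_or_concat l with rfl | ⟨m, x, rfl⟩
        · exact hne hp'
        rw [List.concat_eq_append] at hl' hr' hp' hyb hr
        obtain ⟨c, hm, hx, hxt⟩ := hp'.of_append
        have hx' : x = y := by
          rcases hl' x (by simp) with h | rfl | h
          · exact h
          · simp at hyb
          · rw [← hxt, ← X.o_bar] at hy'
            exact absurd (T.o_mem _ (T.bar_mem x h)) hy'
        subst hx'
        rw [← hx] at hm
        have hrm : X.IsReduced m := (List.isChain_append.1 hr').1
        have hlm : ∀ z ∈ m, z ∈ (T.attach x hy).edges := fun z hz => hl' z (by simp [hz])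
        have hxm : x ∉ m := fun h => hne (hlast _ _ m hlm hm hrm h)
        have := hT.acyclic _ m (hin m hlm hxm fun h => hyb (by simp [h])) hm hrm
        subst this
        exact (List.isChain_cons_cons.1 hr).1 (X.bar_bar x).symm
    · exact hT.acyclic a l (hin l hl (fun h => ha (hlast _ _ l hl hp hr h))
        fun h => ha (hfirst _ _ l hl hp hr h)) hp hr

theorem Sub.IsMaximalSubtree.verts_eq_univ {T : X.Sub} (hT : T.IsMaximalSubtree)
    (hX : X.IsConnected) : T.verts = Set.univ := by
  by_contra hne
  obtain ⟨a, ha⟩ := hT.1.nonempty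
  obtain ⟨b, hb⟩ := (Set.ne_univ_iff_exists_notMem _).1 hne
  obtain ⟨l, hl⟩ := hX.2 a b
  induction l generalizing a with
  | nil => cases hl; exact hb ha
  | cons y l ih =>
    obtain ⟨rfl, hl⟩ := hl
    by_cases hy : X.t y ∈ T.verts
    · exact ih _ hy hl
    · have := hT.2 _ (hT.1.attach y ha hy) (Set.subset_insert _ _)
        ((Set.subset_insert _ _).trans (Set.subset_insert _ _))
      exact hy (this ▸ Or.inl rfl)

end SerreGraph

/-! ### Centrality of chief factors -/

/-- A `p`-group acts trivially by conjugation on a normal section of order `p`: an element `h` acts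
on `𝔽_p` by a scalar `a`, and `a = a ^ p ^ r = 1` for `h` of order `p ^ r`. -/
theorem IsPGroup.map_conj_eq {p : ℕ} [Fact p.Prime] {G : Type*} [Group G] (hG : IsPGroup p G)
    {N : Subgroup G} [hN : N.Normal] (ψ : N →* Multiplicative (ZMod p))
    (hψ : ∀ (n : N) (h : G), ψ n = 1 → ψ ⟨h * n * h⁻¹, hN.conj_mem n n.2 h⟩ = 1)
    (n : N) (h : G) : ψ ⟨h * n * h⁻¹, hN.conj_mem n n.2 h⟩ = ψ n := by
  let conj : G → N → N := fun h n => ⟨h * n * h⁻¹, hN.conj_mem n n.2 h⟩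
  have conj_mul : ∀ h (n n' : N), conj h (n * n') = conj h n * conj h n' := fun h n n' =>
    Subtype.ext (by simp [conj, mul_assoc])
  have conj_pow : ∀ h (n : N) (k : ℕ), conj h (n ^ k) = conj h n ^ k := fun h n k =>
    Subtype.ext (by simp [conj])
  have conj_conj : ∀ h h' (n : N), conj h (conj h' n) = conj (h * h') n := fun h h' n =>
    Subtype.ext (by simp [conj, mul_assoc])
  by_cases htriv : ∀ n, ψ n = 1
  · rw [htriv, htriv]
  push Not at htriv
  obtain ⟨n₀, hn₀⟩ := htriv
  let χ : N → ZMod p := fun n => (ψ n).toAdd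
  have χ_mul : ∀ n n', χ (n * n') = χ n + χ n' := fun n n' => by simp [χ]
  have χ_pow : ∀ n (k : ℕ), χ (n ^ k) = k * χ n := fun n k => by simp [χ]
  have χ_conj : ∀ n h, χ n = 0 → χ (conj h n) = 0 := fun n h hn => hψ n h hn
  have hx₀ : χ n₀ ≠ 0 := hn₀
  have hlin : ∀ n, χ (conj h n) = χ (conj h n₀) / χ n₀ * χ n := by
    intro n
    set k := (-(χ n / χ n₀)).val
    have hk : (k : ZMod p) = -(χ n / χ n₀) := ZMod.natCast_zmod_val _
    have h₀ : χ (n * n₀ ^ k) = 0 := by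
      rw [χ_mul, χ_pow, hk]; field_simp; ring
    have h₁ := χ_conj _ h h₀
    rw [conj_mul, conj_pow, χ_mul, χ_pow, hk] at h₁
    rw [eq_neg_of_add_eq_zero_left h₁]
    field_simp
  set a := χ (conj h n₀) / χ n₀
  have hiter : ∀ (j : ℕ) n, χ (conj (h ^ j) n) = a ^ j * χ n := by
    intro j
    induction j with
    | zero => intro n; simp [conj]
    | succ j ih => intro n; rw [pow_succ, ← conj_conj, ih, hlin, pow_succ, mul_assoc]
  obtain ⟨r, hr⟩ := hG h
  have h₁ := hiter (p ^ r) n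
  rw [hr, ZMod.pow_card_pow, ← hlin] at h₁
  have h₂ : conj 1 n = n := by simp [conj]
  rw [h₂] at h₁
  exact Multiplicative.toAdd.injective h₁.symm

namespace ChiefSeries

variable {p : ℕ} {G : Type w} [Group G]

/-- A homomorphism from a chief factor, regarded as a homomorphism from a term of the series. -/
def onTerm {M : Type*} [Group M] (C : ChiefSeries p G) {k : ℕ} (φ : C.factor k →* M) :
    C.term k →* M :=
  φ.comp (QuotientGroup.mk' _)

theorem onTerm_eq_one_iff {M : Type*} [Group M] (C : ChiefSeries p G) {k : ℕ}
    {φ : C.factor k →* M} (hφ : Function.Injective φ) (n : C.term k) :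
    C.onTerm φ n = 1 ↔ (n : G) ∈ C.term (k + 1) := by
  rw [onTerm, MonoidHom.comp_apply, map_eq_one_iff φ hφ, QuotientGroup.mk'_apply,
    QuotientGroup.eq_one_iff, Subgroup.mem_subgroupOf]

theorem onTerm_conj [Fact p.Prime] (C : ChiefSeries p G) (hG : IsPGroup p G) {k : ℕ}
    {φ : C.factor k →* Multiplicative (ZMod p)} (hφ : Function.Injective φ) (n : C.term k) (h : G) :
    C.onTerm φ ⟨h * n * h⁻¹, (C.normal k).conj_mem n n.2 h⟩ = C.onTerm φ n := by
  refine hG.map_conj_eq _ (fun n h hn => ?_) n h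
  rw [onTerm_eq_one_iff C hφ] at hn ⊢
  exact (C.normal (k + 1)).conj_mem _ hn h

theorem term_antitone (C : ChiefSeries p G) : Antitone C.term :=
  antitone_nat_of_succ_le C.term_succ_le

end ChiefSeries

/-! ### Cocycles on a set with constant stabilizers -/

section Cocycle

variable {H P Ω M : Type*} [Group H] [Group P] [MulAction P Ω] [CommGroup M]

/-- A cocycle for the action of `H` on `Ω` through `τ`, with values in functions on `Ω`. -/
def IsActionCocycle (τ : H →* P) (a : H → Ω → M) : Prop :=
  ∀ g h w, a (g * h) w = a g (τ h • w) * a h w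

/-- A choice of a point `r w` in every orbit, and of elements `k w` that move it to `w`. -/
theorem exists_orbit_section (τ : H →* P) : ∃ (r : Ω → Ω) (k : Ω → H),
    (∀ g w, r (τ g • w) = r w) ∧ ∀ w, τ (k w) • r w = w := by
  let _ : MulAction H Ω := MulAction.compHom Ω τ
  let r : Ω → Ω := fun w => (Quotient.mk (MulAction.orbitRel H Ω) w).out
  have hr : ∀ (g : H) w, r (g • w) = r w := fun g w => by
    have : Quotient.mk (MulAction.orbitRel H Ω) (g • w) = Quotient.mk _ w :=
      Quotient.sound (s := MulAction.orbitRel H Ω) (MulAction.mem_orbit w g)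
    simp only [r, this]
  have hk : ∀ w, ∃ g : H, g • r w = w := fun w => by
    have h : (MulAction.orbitRel H Ω).r (r w) w :=
      Quotient.exact (s := MulAction.orbitRel H Ω) (Quotient.out_eq _)
    exact MulAction.mem_orbit_iff.1 ((MulAction.orbitRel H Ω).symm h)
  choose k hk using hk
  exact ⟨r, k, hr, hk⟩

/-- If all stabilizers equal `N`, an invariant homomorphism on `N` extends to a cocycle. -/
theorem exists_isActionCocycle (τ : H →* P) {N : Subgroup H} [hN : N.Normal]
    (hstab : ∀ (g : H) (w : Ω), τ g • w = w ↔ g ∈ N) (ψ : N →* M)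
    (hψ : ∀ (n : N) (h : H), ψ ⟨h * n * h⁻¹, hN.conj_mem n n.2 h⟩ = ψ n) :
    ∃ a : H → Ω → M, IsActionCocycle τ a ∧ ∀ (n : N) w, a n w = ψ n := by
  obtain ⟨r, k, hr, hk⟩ := exists_orbit_section (Ω := Ω) τ
  have hmem : ∀ g w, (k (τ g • w))⁻¹ * g * k w ∈ N := fun g w => by
    rw [← hstab _ (r w), map_mul, map_mul, map_inv, mul_smul, mul_smul, hk, inv_smul_eq_iff,
      ← hr g w, hk]
  refine ⟨fun g w => ψ ⟨_, hmem g w⟩, fun g h w => ?_, fun n w => ?_⟩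
  · rw [← map_mul]
    refine congrArg ψ (Subtype.ext ?_)
    change (k (τ (g * h) • w))⁻¹ * (g * h) * k w =
      ((k (τ g • τ h • w))⁻¹ * g * k (τ h • w)) * ((k (τ h • w))⁻¹ * h * k w)
    rw [map_mul, mul_smul]; group
  · have hw : τ (n : H) • w = w := (hstab _ _).2 n.2
    rw [← hψ n (k w)⁻¹]
    refine congrArg ψ (Subtype.ext ?_)
    simp only [hw, inv_inv]

/-- Two cocycles that agree on all stabilizers are cohomologous. -/
theorem IsActionCocycle.exists_coboundary {τ : H →* P} {a b : H → Ω → M}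
    (ha : IsActionCocycle τ a) (hb : IsActionCocycle τ b)
    (h : ∀ g w, τ g • w = w → a g w = b g w) :
    ∃ β : Ω → M, ∀ g w, β (τ g • w) * b g w = a g w * β w := by
  obtain ⟨r, k, hr, hk⟩ := exists_orbit_section (Ω := Ω) τ
  let d : H → Ω → M := fun g w => a g w / b g w
  have hd : IsActionCocycle τ d := fun g h w => by
    simp only [d, ha g h w, hb g h w, div_mul_div_comm]
  have hd₁ : ∀ g w, τ g • w = w → d g w = 1 := fun g w hw => div_eq_one.2 (h g w hw)
  refine ⟨fun w => d (k w) (r w), fun g w => ?_⟩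
  have h₁ : d (g * k w) (r w) = d g w * d (k w) (r w) := by
    rw [hd, hk]
  have h₂ : d (g * k w) (r w) = d (k (τ g • w)) (r (τ g • w)) := by
    have hs : τ ((k (τ g • w))⁻¹ * (g * k w)) • r w = r w := by
      rw [map_mul, map_mul, map_inv, mul_smul, mul_smul, hk, inv_smul_eq_iff, ← hr g w, hk]
    have : g * k w = k (τ g • w) * ((k (τ g • w))⁻¹ * (g * k w)) := by group
    rw [this, hd, hs, hd₁ _ _ hs, mul_one, hr]
  have h₃ : d (k (τ g • w)) (r (τ g • w)) = a g w / b g w * d (k w) (r w) := h₂.symm.trans h₁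
  change d (k (τ g • w)) (r (τ g • w)) * b g w = a g w * d (k w) (r w)
  rw [h₃, mul_right_comm, div_mul_cancel]

end Cocycle

/-! ### The wreath product with `𝔽_p` -/

section Wreath

open SemidirectProduct

variable {H P Ω M : Type*} [Group H] [Group P] [MulAction P Ω] [CommGroup M]

theorem IsPGroup.pi_semidirectProduct {p : ℕ} [Fact p.Prime] {Ω M P : Type*} [Group M] [Group P]
    [Finite Ω] [Finite M] [Finite P] (hM : IsPGroup p M) (hP : IsPGroup p P)
    (α : P →* MulAut (Ω → M)) : IsPGroup p ((Ω → M) ⋊[α] P) := by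
  have : Finite ((Ω → M) ⋊[α] P) := Finite.of_equiv _ SemidirectProduct.equivProd.symm
  obtain ⟨a, ha⟩ := IsPGroup.iff_card.1 hP
  obtain ⟨b, hb⟩ := IsPGroup.iff_card.1 hM
  refine IsPGroup.iff_card.2 ⟨b * Nat.card Ω + a, ?_⟩
  rw [SemidirectProduct.card, Nat.card_fun, hb, pow_add, pow_mul, ← ha]

/-- The unrestricted wreath product of `M` with `P` acting on `Ω`. -/
abbrev ActionWreath (Ω M P : Type*) [Group P] [MulAction P Ω] [CommGroup M] : Type _ :=
  (Ω → M) ⋊[mulAutArrow] P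

/-- The imprimitive action of the wreath product. -/
instance : MulAction (ActionWreath Ω M P) (Ω × M) where
  smul x w := (x.right • w.1, x.left (x.right • w.1) * w.2)
  one_smul w := by
    change ((1 : P) • w.1, (1 : M) * w.2) = w
    simp
  mul_smul x y w := by
    change ((x.right * y.right) • w.1, (x.left ((x.right * y.right) • w.1) *
      y.left (x.right⁻¹ • (x.right * y.right) • w.1)) * w.2) =
      (x.right • y.right • w.1, x.left (x.right • y.right • w.1) *
        (y.left (y.right • w.1) * w.2))
    rw [mul_smul, inv_smul_smul, mul_assoc]

theorem ActionWreath.smul_def (x : ActionWreath Ω M P) (w : Ω × M) :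
    x • w = (x.right • w.1, x.left (x.right • w.1) * w.2) := rfl

/-- The homomorphism to the wreath product given by a cocycle. -/
def IsActionCocycle.toWreath {τ : H →* P} {a : H → Ω → M} (ha : IsActionCocycle τ a) :
    H →* ActionWreath Ω M P :=
  MonoidHom.mk' (fun g => ⟨fun w => a g ((τ g)⁻¹ • w), τ g⟩) fun g h => by
    refine SemidirectProduct.ext (funext fun w => ?_) (map_mul τ g h)
    change a (g * h) ((τ (g * h))⁻¹ • w) =
      a g ((τ g)⁻¹ • w) * a h ((τ h)⁻¹ • ((τ g)⁻¹ • w))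
    rw [ha, map_mul, mul_inv_rev, mul_smul, smul_inv_smul]

theorem IsActionCocycle.toWreath_smul {τ : H →* P} {a : H → Ω → M} (ha : IsActionCocycle τ a)
    (g : H) (w : Ω × M) : ha.toWreath g • w = (τ g • w.1, a g w.1 * w.2) := by
  rw [ActionWreath.smul_def]
  change (τ g • w.1, a g ((τ g)⁻¹ • τ g • w.1) * w.2) = _
  rw [inv_smul_smul]

end Wreath

/-! ### Compatible actions of the vertex groups -/

namespace GraphOfGroups

variable {V : Type u} {E : Type v} {X : SerreGraph V E} (𝒢 : GraphOfGroups.{u, v, w, w'} X)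
  {p : ℕ}

/-- The map `f_y`, defined on the group of any geometric edge equal to that of `y`. The freedom in
`e` allows for comparing `f_y` and `f_{bar y}`. -/
def edgeMap {e : X.GeomEdge} (y : E) (h : X.geom y = e) :
    𝒢.edgeGroup e →* 𝒢.vertexGroup (X.t y) :=
  h ▸ 𝒢.f y

@[simp] theorem edgeMap_rfl (y : E) : 𝒢.edgeMap y rfl = 𝒢.f y := rfl

variable {𝒢} {Cv : ∀ a, ChiefSeries p (𝒢.vertexGroup a)} {Ce : ∀ e, ChiefSeries p (𝒢.edgeGroup e)}

theorem SeriesCompatible.edgeMap_mem_iff (hI : 𝒢.SeriesCompatible Cv Ce) {e : X.GeomEdge} (y : E)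
    (h : X.geom y = e) (k : ℕ) (g : 𝒢.edgeGroup e) :
    𝒢.edgeMap y h g ∈ (Cv (X.t y)).term k ↔ g ∈ (Ce e).term k := by
  subst h
  rw [edgeMap_rfl]
  constructor
  · intro hg
    have : 𝒢.f y g ∈ (𝒢.f y).range ⊓ (Cv (X.t y)).term k := ⟨⟨g, rfl⟩, hg⟩
    rw [← hI k y] at this
    obtain ⟨g', hg', h⟩ := this
    rwa [← 𝒢.f_injective y h]
  · exact fun hg => hI.map_le y k ⟨g, hg, rfl⟩

/-- A finite `p`-group `P` acting on a finite nonempty set, and actions of all the vertex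
groups through `P` for which the stabilizer of every point is the `n`-th term of the chief series.
The actions of an edge group through the two adjacent vertex groups are conjugate in `P`. -/
structure CompatibleActions (Cv : ∀ a, ChiefSeries p (𝒢.vertexGroup a)) (n : ℕ) where
  P : Type
  [group : Group P]
  [finite : Finite P]
  isPGroup : IsPGroup p P
  Ω : Type
  [finite_Ω : Finite Ω]
  [nonempty : Nonempty Ω]
  [action : MulAction P Ω]
  τ : ∀ a, 𝒢.vertexGroup a →* P
  smul_eq_iff : ∀ a g (w : Ω), τ a g • w = w ↔ g ∈ (Cv a).term n
  conj : ∀ (e : X.GeomEdge) (y z : E) (hy : X.geom y = e) (hz : X.geom z = e),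
    ∃ c : P, ∀ g, c * τ _ (𝒢.edgeMap y hy g) * c⁻¹ = τ _ (𝒢.edgeMap z hz g)

attribute [instance] CompatibleActions.group CompatibleActions.finite
  CompatibleActions.finite_Ω CompatibleActions.nonempty CompatibleActions.action

/-- Compatible actions exist, by induction on `n`: each step replaces `P` by its wreath product
with `𝔽_p`, and extends the actions by cocycles. These exist because the chief factors are central,
and they agree on edge groups up to coboundaries because they agree on stabilizers. -/
theorem FactorsCompatible.nonempty_compatibleActions [hp : Fact p.Prime]
    (hv : ∀ a, IsPGroup p (𝒢.vertexGroup a)) {hI : 𝒢.SeriesCompatible Cv Ce}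
    (hII : FactorsCompatible hI) (n : ℕ) : Nonempty (CompatibleActions Cv n) := by
  induction n with
  | zero =>
    refine ⟨{ P := Unit, isPGroup := fun g => ⟨0, rfl⟩, Ω := Unit, τ := fun _ => 1,
              smul_eq_iff := fun a g w => ?_, conj := fun _ _ _ _ _ => ⟨1, fun _ => rfl⟩ }⟩
    simp [(Cv a).term_zero]
  | succ n ih =>
    obtain ⟨S⟩ := ih
    obtain ⟨φv, φe, hφv, -, hφ⟩ := hII n
    have hex : ∀ a, ∃ α : 𝒢.vertexGroup a → S.Ω → Multiplicative (ZMod p),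
        IsActionCocycle (S.τ a) α ∧ ∀ (n : (Cv a).term n) w, α n w = (Cv a).onTerm (φv a) n :=
      fun a => exists_isActionCocycle (S.τ a) (S.smul_eq_iff a) ((Cv a).onTerm (φv a))
        ((Cv a).onTerm_conj (hv a) (hφv a))
    choose α hα hαN using hex
    have hedge : ∀ (e : X.GeomEdge) (y : E) (hy : X.geom y = e) (g : (Ce e).term n) w,
        α _ (𝒢.edgeMap y hy g) w = (Ce e).onTerm (φe e) g := by
      rintro e y rfl g w
      have hmem := (hI.edgeMap_mem_iff y rfl n g).2 g.2
      rw [hαN _ ⟨_, hmem⟩ w]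
      exact DFunLike.congr_fun (hφ y) (QuotientGroup.mk' _ g)
    have hfin : Finite (ActionWreath S.Ω (Multiplicative (ZMod p)) S.P) :=
      Finite.of_equiv _ SemidirectProduct.equivProd.symm
    refine ⟨{ P := ActionWreath S.Ω (Multiplicative (ZMod p)) S.P, isPGroup := ?_,
              Ω := S.Ω × Multiplicative (ZMod p), τ := fun a => (hα a).toWreath,
              smul_eq_iff := fun a g w => ?_, conj := fun e y z hy hz => ?_ }⟩
    · exact IsPGroup.pi_semidirectProduct
        (IsPGroup.of_card (n := 1) (by
          rw [Nat.card_eq_fintype_card, Fintype.card_multiplicative, ZMod.card, pow_one]))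
        S.isPGroup _
    · rw [IsActionCocycle.toWreath_smul, Prod.ext_iff, S.smul_eq_iff]
      constructor
      · rintro ⟨h₁, h₂⟩
        rw [hαN a ⟨g, h₁⟩] at h₂
        exact ((Cv a).onTerm_eq_one_iff (hφv a) ⟨g, h₁⟩).1 (mul_eq_right.1 h₂)
      · intro h
        have h₁ := (Cv a).term_succ_le n h
        refine ⟨h₁, ?_⟩
        rw [hαN a ⟨g, h₁⟩]
        exact mul_eq_right.2 (((Cv a).onTerm_eq_one_iff (hφv a) ⟨g, h₁⟩).2 h)
    · obtain ⟨c, hc⟩ := S.conj e y z hy hz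
      have hcz : ∀ (g : 𝒢.edgeGroup e) (w : S.Ω),
          c⁻¹ • S.τ _ (𝒢.edgeMap z hz g) • w = S.τ _ (𝒢.edgeMap y hy g) • c⁻¹ • w := by
        intro g w
        rw [← hc, mul_smul, mul_smul, inv_smul_smul]
      have ha : IsActionCocycle ((S.τ _).comp (𝒢.edgeMap z hz))
          fun g w => α _ (𝒢.edgeMap z hz g) w := fun g h w => by
        beta_reduce; rw [map_mul]; exact hα _ _ _ _
      have hb : IsActionCocycle ((S.τ _).comp (𝒢.edgeMap z hz))
          fun g w => α _ (𝒢.edgeMap y hy g) (c⁻¹ • w) := fun g h w => by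
        beta_reduce; rw [map_mul, MonoidHom.comp_apply, hcz]; exact hα _ _ _ _
      obtain ⟨β, hβ⟩ := ha.exists_coboundary hb (by
        intro g w hgw
        rw [MonoidHom.comp_apply, S.smul_eq_iff, hI.edgeMap_mem_iff] at hgw
        rw [hedge e z hz ⟨g, hgw⟩, hedge e y hy ⟨g, hgw⟩])
      refine ⟨⟨β, c⟩, fun g => ?_⟩
      rw [mul_inv_eq_iff_eq_mul]
      refine SemidirectProduct.ext (funext fun w => ?_) (mul_inv_eq_iff_eq_mul.1 (hc g))
      change β w * α _ (𝒢.edgeMap y hy g) ((S.τ _ (𝒢.edgeMap y hy g))⁻¹ • c⁻¹ • w) =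
        α _ (𝒢.edgeMap z hz g) ((S.τ _ (𝒢.edgeMap z hz g))⁻¹ • w) *
          β ((S.τ _ (𝒢.edgeMap z hz g))⁻¹ • w)
      have := hβ g ((S.τ _ (𝒢.edgeMap z hz g))⁻¹ • w)
      rw [← this, MonoidHom.comp_apply, smul_inv_smul, ← map_inv, ← map_inv, ← map_inv, ← map_inv,
        hcz]

end GraphOfGroups

/-! ### A finite `p`-quotient of a free group detecting an alternating word -/

section Unitriangular

variable (p : ℕ) [hp : Fact p.Prime] (m : ℕ)

theorem Matrix.pow_apply_eq_zero_of_strictUpper {R : Type*} [Ring R] {m : ℕ}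
    {M : Matrix (Fin m) (Fin m) R} (hM : ∀ i j, j ≤ i → M i j = 0) (r : ℕ) (i j : Fin m)
    (h : (j : ℕ) < i + r) : (M ^ r) i j = 0 := by
  induction r generalizing j with
  | zero => rw [pow_zero, Matrix.one_apply_ne]; rintro rfl; omega
  | succ r ih =>
    rw [pow_succ, Matrix.mul_apply]
    refine Finset.sum_eq_zero fun k _ => ?_
    by_cases hk : (k : ℕ) < i + r
    · rw [ih k hk, zero_mul]
    · rw [hM k j (Fin.le_def.2 (by omega)), mul_zero]

/-- The monoid of upper unitriangular matrices over `𝔽_p`; in fact a group. -/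
def Unitriangular : Submonoid (Matrix (Fin m) (Fin m) (ZMod p)) where
  carrier := {M | ∀ i j, j ≤ i → (M - 1) i j = 0}
  one_mem' := by simp
  mul_mem' := by
    intro M N hM hN i j hij
    have : M * N - 1 = (M - 1) * (N - 1) + (M - 1) + (N - 1) := by noncomm_ring
    rw [this, Matrix.add_apply, Matrix.add_apply, hM i j hij, hN i j hij, add_zero, add_zero,
      Matrix.mul_apply]
    refine Finset.sum_eq_zero fun k _ => ?_
    rcases le_total k i with hk | hk
    · rw [hM i k hk, zero_mul]
    · rw [hN k j (hij.trans hk), mul_zero]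

variable {p m}

theorem Unitriangular.pow_prime_pow (M : Unitriangular p m) : M ^ p ^ m = 1 := by
  rcases Nat.eq_zero_or_pos m with rfl | hm
  · exact Subtype.ext (Subsingleton.elim _ _)
  have : Nonempty (Fin m) := ⟨⟨0, hm⟩⟩
  ext1
  have h := M.2
  have h₁ : ((M : Matrix (Fin m) (Fin m) (ZMod p)) - 1) ^ p ^ m = 0 := by
    ext i j
    refine Matrix.pow_apply_eq_zero_of_strictUpper h _ i j ?_
    have := Nat.lt_pow_self (n := m) hp.out.one_lt
    omega
  rw [sub_pow_char_pow_of_commute p _ (Commute.one_right _), one_pow, sub_eq_zero] at h₁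
  simpa using h₁

/-- Inverses are powers, as `M ^ p ^ m = 1`. -/
noncomputable instance : Group (Unitriangular p m) where
  inv M := M ^ (p ^ m - 1)
  inv_mul_cancel M := by
    change M ^ (p ^ m - 1) * M = 1
    rw [← pow_succ, Nat.sub_add_cancel (Nat.pow_pos hp.out.pos), Unitriangular.pow_prime_pow]

theorem Unitriangular.isPGroup : IsPGroup p (Unitriangular p m) :=
  fun M => ⟨m, Unitriangular.pow_prime_pow M⟩

end Unitriangular

section Detect

open Matrix

variable {ι : Type*} (p : ℕ)

open Classical in
/-- The nilpotent matrix with a one in position `(a, a + 1)` for each `a` with `s a = i`. -/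
noncomputable def stepMatrix (m : ℕ) (s : ℕ → ι) (i : ι) : Matrix (Fin m) (Fin m) (ZMod p) :=
  Matrix.of fun a b => if (b : ℕ) = a + 1 ∧ s a = i then 1 else 0

variable {p}

theorem stepMatrix_mul_self {m : ℕ} {s : ℕ → ι} (hs : ∀ a, a + 2 < m → s a ≠ s (a + 1)) (i : ι) :
    stepMatrix p m s i * stepMatrix p m s i = 0 := by
  ext a b
  rw [Matrix.mul_apply, Matrix.zero_apply]
  refine Finset.sum_eq_zero fun c _ => ?_
  simp only [stepMatrix, Matrix.of_apply, ← ite_and, mul_ite, mul_one, mul_zero]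
  refine if_neg ?_
  rintro ⟨⟨hbc, hc⟩, hca, ha⟩
  have hb := b.2
  rw [hca] at hc
  exact hs a (by omega) (ha.trans hc.symm)

/-- A nonempty word in a free group in which adjacent letters always are powers of distinct
generators survives in a finite `p`-group. The generator `i` is sent to the unipotent matrix
`1 + N i`, where `N i` has a one in position `(a, a + 1)` whenever the `a`-th letter of the word
is `i ^ (± 1)`. As `N i ^ 2 = 0`, the word is sent to a product of factors `1 ± N i`, and the
upper right corner of this product is `± 1`. -/
theorem FreeGroup.exists_isPGroup_of_isChain [hp : Fact p.Prime] (L : List (ι × Bool))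
    (hL : L.IsChain fun a b => a.1 ≠ b.1) (hne : L ≠ []) :
    ∃ (U : Type) (_ : Group U) (_ : Finite U) (φ : FreeGroup ι →* U),
      IsPGroup p U ∧ φ (FreeGroup.mk L) ≠ 1 := by
  classical
  set m := L.length with hm
  obtain ⟨x₀, hx₀⟩ := List.exists_mem_of_ne_nil L hne
  let s : ℕ → ι := fun a => (L.getD a x₀).1
  let N : ι → Matrix (Fin (m + 1)) (Fin (m + 1)) (ZMod p) := stepMatrix p (m + 1) s
  have hs : ∀ a, a + 2 < m + 1 → s a ≠ s (a + 1) := by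
    intro a ha
    have h := List.isChain_iff_getElem.1 hL a (by omega)
    simp only [s, List.getD_eq_getElem?_getD]
    rwa [List.getElem?_eq_getElem (by omega), List.getElem?_eq_getElem (by omega)]
  have hN : ∀ i, N i * N i = 0 := stepMatrix_mul_self hs
  have hmem : ∀ i, 1 + N i ∈ Unitriangular p (m + 1) := by
    intro i a b hab
    rw [add_sub_cancel_left]
    refine if_neg fun h => ?_
    have := Fin.le_def.1 hab
    omega
  let g : ι → Unitriangular p (m + 1) := fun i => ⟨1 + N i, hmem i⟩
  have hinv : ∀ i, (((g i)⁻¹ : Unitriangular p (m + 1)) :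
      Matrix (Fin (m + 1)) (Fin (m + 1)) (ZMod p)) = 1 - N i := by
    intro i
    have h : ((((g i)⁻¹ * g i : Unitriangular p (m + 1))) :
      Matrix (Fin (m + 1)) (Fin (m + 1)) (ZMod p)) = 1 := by rw [inv_mul_cancel]; rfl
    have h₂ : (1 + N i) * (1 - N i) = 1 := by
      rw [mul_sub, mul_one, add_mul, one_mul, hN]; abel
    rw [Submonoid.coe_mul] at h
    exact left_inv_eq_right_inv h h₂
  have hcoe : ∀ x : ι × Bool, ∃ ε : ZMod p, ε ≠ 0 ∧
      ((cond x.2 (g x.1) (g x.1)⁻¹ : Unitriangular p (m + 1)) :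
        Matrix (Fin (m + 1)) (Fin (m + 1)) (ZMod p)) = 1 + ε • N x.1 := by
    rintro ⟨i, _ | _⟩
    · exact ⟨-1, by simp, by simp [hinv, sub_eq_add_neg]⟩
    · exact ⟨1, one_ne_zero, by simp [g]⟩
  have key : ∀ L' : List (ι × Bool), L' <+: L →
      (∀ b : Fin (m + 1), L'.length < b →
        ((FreeGroup.lift g (FreeGroup.mk L') : Unitriangular p (m + 1)) :
          Matrix (Fin (m + 1)) (Fin (m + 1)) (ZMod p)) 0 b = 0) ∧
      ∀ b : Fin (m + 1), (b : ℕ) = L'.length →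
        ((FreeGroup.lift g (FreeGroup.mk L') : Unitriangular p (m + 1)) :
          Matrix (Fin (m + 1)) (Fin (m + 1)) (ZMod p)) 0 b ≠ 0 := by
    intro L'
    induction L' using List.reverseRecOn with
    | nil =>
      intro _
      have : FreeGroup.mk ([] : List (ι × Bool)) = 1 := rfl
      rw [this, _root_.map_one, Submonoid.coe_one]
      refine ⟨fun b hb => Matrix.one_apply_ne ?_, fun b hb => ?_⟩
      · rintro rfl; simp at hb
      · obtain rfl : b = 0 := Fin.ext hb
        simp
    | append_singleton L' x ih =>
      intro hpre
      obtain ⟨h₀, h₁⟩ := ih ((List.prefix_append _ _).trans hpre)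
      have hlen := hpre.length_le
      rw [List.length_append, List.length_singleton] at hlen
      have hsx : s L'.length = x.1 := by
        obtain ⟨L'', rfl⟩ := hpre
        simp [s]
      rw [← FreeGroup.mul_mk, _root_.map_mul, Submonoid.coe_mul]
      have hx : FreeGroup.lift g (FreeGroup.mk [x]) = cond x.2 (g x.1) (g x.1)⁻¹ := by
        simp [FreeGroup.lift_mk]
      obtain ⟨ε, hε, hx'⟩ := hcoe x
      rw [hx, hx', mul_add, mul_one, Matrix.mul_smul]
      set A : Matrix (Fin (m + 1)) (Fin (m + 1)) (ZMod p) :=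
        ((FreeGroup.lift g (FreeGroup.mk L') : Unitriangular p (m + 1)) :
          Matrix (Fin (m + 1)) (Fin (m + 1)) (ZMod p))
      constructor
      · intro b hb
        rw [List.length_append, List.length_singleton] at hb
        rw [Matrix.add_apply, h₀ b (by omega), Matrix.smul_apply, Matrix.mul_apply,
          Finset.sum_eq_zero, smul_zero, add_zero]
        intro c _
        by_cases hc : L'.length < c
        · rw [h₀ c hc, zero_mul]
        · have : N x.1 c b = 0 := if_neg (by omega)
          rw [this, mul_zero]
      · intro b hb
        rw [List.length_append, List.length_singleton] at hb
        have hc : L'.length < m + 1 := by omega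
        rw [Matrix.add_apply, h₀ b (by omega), Matrix.smul_apply, Matrix.mul_apply,
          Finset.sum_eq_single (⟨L'.length, hc⟩ : Fin (m + 1)), zero_add]
        · have : N x.1 ⟨L'.length, hc⟩ b = 1 := if_pos ⟨hb, hsx⟩
          rw [this, mul_one, smul_eq_mul]
          exact mul_ne_zero hε (h₁ _ rfl)
        · intro c _ hcne
          have : N x.1 c b = 0 := if_neg fun h => hcne (Fin.ext (by simp; omega))
          rw [this, mul_zero]
        · simp
  refine ⟨Unitriangular p (m + 1), inferInstance, inferInstance, FreeGroup.lift g,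
    Unitriangular.isPGroup, fun h => ?_⟩
  refine (key L (List.prefix_refl L)).2 (Fin.last m) (by simp [hm]) ?_
  rw [h, Submonoid.coe_one, Matrix.one_apply_ne]
  intro h'
  have := congrArg Fin.val h'
  have hpos : 0 < m := List.length_pos_of_ne_nil hne
  simp at this
  omega

end Detect

/-! ### Generic conjugators: a semidirect product of a free group and a finite `p`-group -/

section

open scoped Pointwise

/-- The action of a group `P` on the free group on `E × Set P` that translates the letters. Only
the letters `(y, S)` with `S` a coset of a subgroup attached to `y` matter below; such a letter is
fixed by the stabilizer of the coset. -/
def translateAut (E : Type v) (P : Type*) [Group P] : P →* MulAut (FreeGroup (E × Set P)) where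
  toFun q := FreeGroup.freeGroupCongr ((Equiv.refl E).prodCongr (MulAction.toPerm q))
  map_one' := by
    apply MulEquiv.toMonoidHom_injective
    ext ⟨y, S⟩
    simp
  map_mul' q r := by
    apply MulEquiv.toMonoidHom_injective
    ext ⟨y, S⟩
    simp [mul_smul]

@[simp] theorem translateAut_of {E : Type v} {P : Type*} [Group P] (q : P) (y : E) (S : Set P) :
    translateAut E P q (FreeGroup.of (y, S)) = FreeGroup.of (y, q • S) := by
  simp [translateAut]

/-- The group in which conjugating elements of `P` can be perturbed freely. -/
abbrev GenericGroup (E : Type v) (P : Type*) [Group P] : Type _ :=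
  FreeGroup (E × Set P) ⋊[translateAut E P] P

open SemidirectProduct

/-- A homomorphism from the kernel of a split extension by a finite `p`-group to a finite
`p`-group extends to the whole group, with values in a wreath product. -/
theorem SemidirectProduct.exists_isPGroup_of_left {p : ℕ} [hp : Fact p.Prime] {F : Type*}
    [Group F] {P U : Type} [Group P] [Finite P] (hP : IsPGroup p P) [Group U] [Finite U]
    (hU : IsPGroup p U) (α : P →* MulAut F) (φ : F →* U) (x : F ⋊[α] P) (hx : φ x.left ≠ 1) :
    ∃ (K : Type) (_ : Group K) (_ : Finite K) (ψ : F ⋊[α] P →* K), IsPGroup p K ∧ ψ x ≠ 1 := by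
  let fn : F →* (P → U) := MonoidHom.pi fun h => φ.comp (α h⁻¹).toMonoidHom
  let ψ : F ⋊[α] P →* (P → U) ⋊[mulAutArrow] P :=
    SemidirectProduct.map fn (MonoidHom.id P) (by
      intro g
      ext n h
      simp only [MonoidHom.comp_apply, fn, MulEquiv.coe_toMonoidHom,
        MonoidHom.id_apply, mulAutArrow_apply_apply]
      change φ (α h⁻¹ (α g n)) = φ (α (g⁻¹ * h)⁻¹ n)
      rw [mul_inv_rev, inv_inv, map_mul, MulAut.mul_apply])
  have : Finite ((P → U) ⋊[mulAutArrow] P) := Finite.of_equiv _ SemidirectProduct.equivProd.symm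
  refine ⟨(P → U) ⋊[mulAutArrow] P, inferInstance, this, ψ, hU.pi_semidirectProduct hP _,
    fun h => hx ?_⟩
  have := congrFun (congrArg SemidirectProduct.left h) 1
  change φ (α (1 : P)⁻¹ x.left) = 1 at this
  simpa using this

theorem GenericGroup.inr_mul_inl_of {E : Type v} {P : Type*} [Group P] {q : P} (y : E) (S : Set P) :
    (inr q * inl (FreeGroup.of (y, S)) : GenericGroup E P) =
      inl (FreeGroup.of (y, q • S)) * inr q := by
  rw [← translateAut_of, inl_aut, inv_eq_iff_eq_inv.1 (map_inv inr q).symm]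
  simp

theorem GenericGroup.commute_inr_inl_of {E : Type v} {P : Type*} [Group P] {H : Subgroup P} {q : P}
    (hq : q ∈ H) (y : E) :
    Commute (inr q : GenericGroup E P) (inl (FreeGroup.of (y, (H : Set P)))) := by
  rw [Commute, SemiconjBy, GenericGroup.inr_mul_inl_of, smul_coe_set hq]

namespace SerreGraph

variable {V : Type u} {E : Type v} (X : SerreGraph V E) {P : Type} [Group P]
  (B : E → Subgroup P) (c : E → P)

/-- The conjugator `c y`, multiplied on both sides by free letters that commute with the subgroups
`B (bar y)` and `B y`. -/
def conjugator (y : E) : GenericGroup E P :=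
  inl (FreeGroup.of (y, (B (X.bar y) : Set P))) * inr (c y) *
    (inl (FreeGroup.of (X.bar y, (B y : Set P))))⁻¹

variable {c} in
theorem conjugator_bar (hc : ∀ y, c (X.bar y) = (c y)⁻¹) (y : E) :
    X.conjugator B c (X.bar y) = (X.conjugator B c y)⁻¹ := by
  simp only [conjugator, X.bar_bar, hc, map_inv, mul_inv_rev, inv_inv, mul_assoc]

theorem conjugator_mul_inr {y : E} {q r : P} (hq : q ∈ B y) (hr : r ∈ B (X.bar y))
    (h : c y * q * (c y)⁻¹ = r) :
    X.conjugator B c y * inr q * (X.conjugator B c y)⁻¹ = inr r := by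
  have h₁ := (GenericGroup.commute_inr_inl_of hq (X.bar y)).inv_right
  have h₂ := GenericGroup.commute_inr_inl_of hr y
  have h₃ : (inr (c y) * inr q : GenericGroup E P) = inr r * inr (c y) := by
    rw [← map_mul, ← map_mul, ← h]; simp
  rw [mul_inv_eq_iff_eq_mul]
  unfold conjugator
  simp only [mul_assoc]
  rw [← h₁.eq, ← mul_assoc (inr (c y)), h₃, ← mul_assoc (inr r), h₂.eq]
  simp only [mul_assoc]

/-- The free part of the word `q C(y₁) γ₁ C(y₂) γ₂ ⋯`, where `C` is the conjugator. -/
def freeLetters : P → List (E × P) → List ((E × Set P) × Bool)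
  | _, [] => []
  | q, (y, γ) :: M => ((y, q • (B (X.bar y) : Set P)), true) ::
      ((X.bar y, (q * c y) • (B y : Set P)), false) :: freeLetters (q * c y * γ) M

theorem left_inr_mul_prod (q : P) (M : List (E × P)) :
    (inr q * (M.map fun x => X.conjugator B c x.1 * inr x.2).prod : GenericGroup E P).left =
      FreeGroup.mk (X.freeLetters B c q M) := by
  induction M generalizing q with
  | nil => simp [freeLetters, FreeGroup.one_eq_mk]
  | cons x M ih =>
    obtain ⟨y, γ⟩ := x
    have h : (inr q * (((y, γ) :: M).map fun x => X.conjugator B c x.1 * inr x.2).prod :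
        GenericGroup E P) =
        inl (FreeGroup.of (y, q • (B (X.bar y) : Set P))) *
        inl (FreeGroup.of (X.bar y, (q * c y) • (B y : Set P)))⁻¹ *
        (inr (q * c y * γ) * (M.map fun x => X.conjugator B c x.1 * inr x.2).prod) := by
      have h₁ := GenericGroup.inr_mul_inl_of (q := q * c y) (X.bar y) (B y : Set P)
      have h₂ : (inr (q * c y) * (inl (FreeGroup.of (X.bar y, (B y : Set P))))⁻¹ :
          GenericGroup E P) =
          (inl (FreeGroup.of (X.bar y, (q * c y) • (B y : Set P))))⁻¹ * inr (q * c y) := by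
        rw [mul_inv_eq_iff_eq_mul, mul_assoc, h₁, inv_mul_cancel_left]
      rw [List.map_cons, List.prod_cons, map_mul inr (q * c y) γ]
      simp only [conjugator, ← mul_assoc, map_inv]
      rw [GenericGroup.inr_mul_inl_of, mul_assoc _ (inr q) (inr (c y)), ← map_mul,
        mul_assoc _ (inr (q * c y)), h₂]
      simp only [mul_assoc]
    rw [h, ← map_mul, mul_left, left_inl, right_inl, map_one, MulAut.one_apply, ih, freeLetters,
      FreeGroup.of, FreeGroup.of, FreeGroup.inv_mk, FreeGroup.mul_mk, FreeGroup.mul_mk]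
    rfl

variable {B} in
/-- In a word without backtracking, adjacent free letters are distinct: a backtrack
`y, γ, bar y` would be needed, with `γ` in the subgroup `B y`. -/
theorem isChain_freeLetters (q : P) (M : List (E × P))
    (hM : M.IsChain fun x z => z.1 = X.bar x.1 → x.2 ∉ B x.1) :
    (X.freeLetters B c q M).IsChain fun a b => a.1 ≠ b.1 := by
  induction M generalizing q with
  | nil => exact List.isChain_nil
  | cons x M ih =>
    obtain ⟨y, γ⟩ := x
    have hy : ∀ S S' : Set P, (y, S) ≠ (X.bar y, S') :=
      fun S S' h => X.bar_ne y (congrArg Prod.fst h).symm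
    cases M with
    | nil => exact List.isChain_cons_cons.2 ⟨hy _ _, List.isChain_singleton _⟩
    | cons z M =>
      obtain ⟨z, δ⟩ := z
      obtain ⟨h₁, h₂⟩ := List.isChain_cons_cons.1 hM
      refine List.isChain_cons_cons.2 ⟨hy _ _, List.isChain_cons_cons.2 ⟨fun h => ?_, ih _ h₂⟩⟩
      obtain ⟨hz, hS⟩ := Prod.mk.inj h
      refine h₁ hz.symm ?_
      rw [← hz, X.bar_bar, mul_smul (q * c y) γ, smul_left_cancel_iff] at hS
      rw [← SetLike.mem_coe, hS]
      exact ⟨1, (B y).one_mem, by simp⟩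

variable {B} in
theorem exists_isPGroup_of_no_backtrack {p : ℕ} [Fact p.Prime] [Finite P] (hP : IsPGroup p P)
    (q : P) (M : List (E × P)) (hne : M ≠ [])
    (hM : M.IsChain fun x z => z.1 = X.bar x.1 → x.2 ∉ B x.1) :
    ∃ (K : Type) (_ : Group K) (_ : Finite K) (ψ : GenericGroup E P →* K), IsPGroup p K ∧
      ψ (inr q * (M.map fun x => X.conjugator B c x.1 * inr x.2).prod) ≠ 1 := by
  obtain ⟨U, _, _, φ, hU, hφ⟩ := FreeGroup.exists_isPGroup_of_isChain (p := p) _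
    (X.isChain_freeLetters c q M hM) (by
      cases M with
      | nil => exact absurd rfl hne
      | cons x M => exact List.cons_ne_nil _ _)
  refine SemidirectProduct.exists_isPGroup_of_left hP hU _ φ _ ?_
  rwa [left_inr_mul_prod]

end SerreGraph

end

/-! ### Presentation of the fundamental group -/

namespace SerreGraph

variable {V : Type u} {E : Type v} {X : SerreGraph V E}

theorem geom_eq_iff {y z : E} : X.geom y = X.geom z ↔ z = y ∨ z = X.bar y :=
  Quotient.eq (r := X.geomSetoid)

theorem IsOrientation.bar_mem_iff {O : Set E} (hO : X.IsOrientation O) (y : E) :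
    X.bar y ∈ O ↔ y ∉ O := by
  rcases hO y with ⟨h₁, h₂⟩ | ⟨h₁, h₂⟩ <;> simp [h₁, h₂]

end SerreGraph

namespace GraphOfGroups

variable {V : Type u} {E : Type v} {X : SerreGraph V E} (𝒢 : GraphOfGroups.{u, v, w, w'} X)
  (T : X.Sub) (O : Set E)

/-- The map from a vertex group to the fundamental group. -/
def vertexHom (a : V) : 𝒢.vertexGroup a →* 𝒢.FundamentalGroup T O :=
  (QuotientGroup.mk' _).comp (𝒢.ofVertex a)

/-- The class of the letter `s_y`. -/
def letterClass (y : E) : 𝒢.FundamentalGroup T O :=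
  QuotientGroup.mk' _ (𝒢.letter y)

open Classical in
/-- The element `s_y` for `y` positive and its inverse for `y` negative: with this sign, opposite
edges have inverse elements, and conjugation by the element of `y` carries `f_y` to `f_{bar y}`. -/
noncomputable def edgeElement (y : E) : 𝒢.FundamentalGroup T O :=
  if y ∈ O then 𝒢.letterClass T O y else (𝒢.letterClass T O y)⁻¹

variable {𝒢 T O}

theorem mk_eq_mk_of_relation {a b : 𝒢.PreGroup} (h : 𝒢.Relation T O a b) :
    (QuotientGroup.mk' (Subgroup.normalClosure (𝒢.relators T O)) a) = QuotientGroup.mk' _ b := by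
  rw [← mul_inv_eq_one, ← map_inv, ← map_mul, QuotientGroup.mk'_apply, QuotientGroup.eq_one_iff]
  exact Subgroup.subset_normalClosure ⟨a, b, h, rfl⟩

theorem letterClass_bar (y : E) : 𝒢.letterClass T O (X.bar y) = 𝒢.letterClass T O y :=
  mk_eq_mk_of_relation (.bar y)

theorem mk_ofEdge_of_notMem {e : X.GeomEdge} {y : E} (h : X.geom y = e) (hy : y ∉ O)
    (g : 𝒢.edgeGroup e) :
    QuotientGroup.mk' (Subgroup.normalClosure (𝒢.relators T O)) (𝒢.ofEdge e g) =
      𝒢.vertexHom T O _ (𝒢.edgeMap y h g) := by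
  subst h
  rw [mk_eq_mk_of_relation (.edge y g), edgeSign, if_neg hy]
  simp [vertexHom]

theorem mk_ofEdge_of_mem {e : X.GeomEdge} {y : E} (h : X.geom y = e) (hy : y ∈ O)
    (g : 𝒢.edgeGroup e) :
    QuotientGroup.mk' (Subgroup.normalClosure (𝒢.relators T O)) (𝒢.ofEdge e g) =
      𝒢.letterClass T O y * 𝒢.vertexHom T O _ (𝒢.edgeMap y h g) * (𝒢.letterClass T O y)⁻¹ := by
  subst h
  rw [mk_eq_mk_of_relation (.edge y g), edgeSign, if_pos hy]
  simp [vertexHom, letterClass]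

theorem edgeElement_bar (hO : X.IsOrientation O) (y : E) :
    𝒢.edgeElement T O (X.bar y) = (𝒢.edgeElement T O y)⁻¹ := by
  have h := hO.bar_mem_iff y
  by_cases hy : y ∈ O
  · rw [edgeElement, edgeElement, if_pos hy, if_neg (by tauto), letterClass_bar]
  · rw [edgeElement, edgeElement, if_neg hy, if_pos (by tauto), letterClass_bar, inv_inv]

theorem edgeElement_of_mem_edges {y : E} (hy : y ∈ T.edges) : 𝒢.edgeElement T O y = 1 := by
  have : 𝒢.letterClass T O y = 1 := (mk_eq_mk_of_relation (.tree y hy)).trans (map_one _)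
  simp [edgeElement, this]

theorem edgeElement_mul_vertexHom (hO : X.IsOrientation O) {e : X.GeomEdge} (y : E)
    (h : X.geom y = e) (h' : X.geom (X.bar y) = e) (g : 𝒢.edgeGroup e) :
    𝒢.edgeElement T O y * 𝒢.vertexHom T O _ (𝒢.edgeMap y h g) * (𝒢.edgeElement T O y)⁻¹ =
      𝒢.vertexHom T O _ (𝒢.edgeMap (X.bar y) h' g) := by
  by_cases hy : y ∈ O
  · have hy' : X.bar y ∉ O := by rwa [hO.bar_mem_iff, not_not]
    rw [← mk_ofEdge_of_notMem h' hy', mk_ofEdge_of_mem h hy, edgeElement, if_pos hy]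
  · have hy' : X.bar y ∈ O := by rwa [hO.bar_mem_iff]
    rw [← mk_ofEdge_of_notMem h hy, mk_ofEdge_of_mem h' hy', edgeElement, if_neg hy,
      letterClass_bar]
    group

/-- The edge groups are not needed to generate, since they are identified with subgroups of
vertex groups. -/
theorem fundamentalGroup_induction {S : Subgroup (𝒢.FundamentalGroup T O)}
    (hv : ∀ a g, 𝒢.vertexHom T O a g ∈ S) (he : ∀ y, 𝒢.edgeElement T O y ∈ S)
    (x : 𝒢.FundamentalGroup T O) : x ∈ S := by
  have hl : ∀ y, 𝒢.letterClass T O y ∈ S := by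
    intro y
    have := he y
    rw [edgeElement] at this
    split_ifs at this with h
    · exact this
    · exact inv_mem_iff.1 this
  have hedge : ∀ e g, QuotientGroup.mk' (Subgroup.normalClosure (𝒢.relators T O))
      (𝒢.ofEdge e g) ∈ S := by
    intro e g
    obtain ⟨y, rfl⟩ : ∃ y, X.geom y = e := Quotient.exists_rep e
    by_cases hy : y ∈ O
    · rw [mk_ofEdge_of_mem rfl hy]
      exact S.mul_mem (S.mul_mem (hl y) (hv _ _)) (S.inv_mem (hl y))
    · rw [mk_ofEdge_of_notMem rfl hy]
      exact hv _ _
  obtain ⟨x, rfl⟩ := QuotientGroup.mk'_surjective _ x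
  suffices h : S.comap (QuotientGroup.mk' _) = ⊤ by
    have : x ∈ S.comap (QuotientGroup.mk' _) := h ▸ Subgroup.mem_top x
    exact this
  rw [eq_top_iff]
  rintro x -
  induction x using Monoid.Coprod.induction_on with
  | inl x =>
    induction x using Monoid.CoprodI.induction_on with
    | one => rw [map_one]; exact Subgroup.one_mem _
    | of a g => exact hv a g
    | mul x y hx hy => rw [map_mul]; exact Subgroup.mul_mem _ hx hy
  | inr x =>
    induction x using Monoid.Coprod.induction_on with
    | inl x =>
      induction x using Monoid.CoprodI.induction_on with
      | one => rw [map_one, map_one]; exact Subgroup.one_mem _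
      | of a g => exact hedge a g
      | mul x y hx hy => rw [map_mul, map_mul]; exact Subgroup.mul_mem _ hx hy
    | inr x =>
      induction x using FreeGroup.induction_on with
      | C1 => rw [map_one, map_one]; exact Subgroup.one_mem _
      | of y => exact hl y
      | inv_of y hy => rw [map_inv, map_inv]; exact Subgroup.inv_mem _ hy
      | mul x y hx hy => rw [map_mul, map_mul]; exact Subgroup.mul_mem _ hx hy
    | mul x y hx hy => rw [map_mul]; exact Subgroup.mul_mem _ hx hy
  | mul x y hx hy => exact Subgroup.mul_mem _ hx hy

/-- The universal property of the fundamental group. -/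
theorem exists_fundamentalGroup_hom (hO : X.IsOrientation O) {Q : Type*} [Group Q]
    (ν : ∀ a, 𝒢.vertexGroup a →* Q) (D : E → Q) (hbar : ∀ y, D (X.bar y) = (D y)⁻¹)
    (htree : ∀ y ∈ T.edges, D y = 1)
    (hrel : ∀ (y : E) (g : 𝒢.edgeGroup (X.geom y)),
      D y * ν _ (𝒢.f y g) * (D y)⁻¹ = ν _ (𝒢.edgeMap (X.bar y) (X.geom_bar y) g)) :
    ∃ Φ : 𝒢.FundamentalGroup T O →* Q,
      (∀ a g, Φ (𝒢.vertexHom T O a g) = ν a g) ∧ ∀ y, Φ (𝒢.edgeElement T O y) = D y := by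
  classical
  have hneg : ∀ e : X.GeomEdge, ∃ y, X.geom y = e ∧ y ∉ O := by
    intro e
    obtain ⟨y, rfl⟩ : ∃ y, X.geom y = e := Quotient.exists_rep e
    by_cases hy : y ∈ O
    · exact ⟨X.bar y, X.geom_bar y, by rwa [hO.bar_mem_iff, not_not]⟩
    · exact ⟨y, rfl, hy⟩
  choose r hr hrO using hneg
  let ε : ∀ e, 𝒢.edgeGroup e →* Q := fun e => (ν _).comp (𝒢.edgeMap (r e) (hr e))
  have hε : ∀ (e) (y : E) (hy : X.geom y = e), y ∉ O → ∀ g, ε e g = ν _ (𝒢.edgeMap y hy g) := by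
    intro e y hy hyO g
    have : r e = y := by
      rcases SerreGraph.geom_eq_iff.1 (hy.trans (hr e).symm) with h | h
      · exact h
      · refine absurd ((hO.bar_mem_iff y).2 hyO) (h ▸ hrO e)
    subst this
    rfl
  let lt : E → Q := fun y => if y ∈ O then D y else D (X.bar y)
  let Ψ : 𝒢.PreGroup →* Q := Monoid.Coprod.lift (Monoid.CoprodI.lift ν)
    (Monoid.Coprod.lift (Monoid.CoprodI.lift ε) (FreeGroup.lift lt))
  have hΨv : ∀ a g, Ψ (𝒢.ofVertex a g) = ν a g := fun a g =>
    (Monoid.Coprod.lift_apply_inl _ _ _).trans (Monoid.CoprodI.lift_of ν g)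
  have hΨe : ∀ a g, Ψ (𝒢.ofEdge a g) = ε a g := fun a g =>
    (Monoid.Coprod.lift_apply_inr _ _ _).trans
      ((Monoid.Coprod.lift_apply_inl _ _ _).trans (Monoid.CoprodI.lift_of ε g))
  have hΨl : ∀ y, Ψ (𝒢.letter y) = lt y := fun y =>
    (Monoid.Coprod.lift_apply_inr _ _ _).trans
      ((Monoid.Coprod.lift_apply_inr _ _ _).trans FreeGroup.lift_apply_of)
  have hΨ : Subgroup.normalClosure (𝒢.relators T O) ≤ Ψ.ker := by
    refine Subgroup.normalClosure_le_normal ?_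
    rintro _ ⟨a, b, h, rfl⟩
    rw [SetLike.mem_coe, MonoidHom.mem_ker, map_mul, map_inv, mul_inv_eq_one]
    cases h with
    | edge y g =>
      rw [hΨe, map_mul, map_mul, map_zpow, map_zpow, hΨv, hΨl, edgeSign]
      by_cases hy : y ∈ O
      · rw [hε _ (X.bar y) (X.geom_bar y) (by rwa [hO.bar_mem_iff, not_not]), ← hrel]
        simp [hy, lt]
      · rw [hε _ y rfl hy]
        simp [hy]
    | tree y hy =>
      rw [hΨl, map_one]
      simp only [lt, htree y hy, htree _ (T.bar_mem y hy), ite_self]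
    | bar y =>
      rw [hΨl, hΨl]
      simp only [lt, hO.bar_mem_iff, X.bar_bar]
      by_cases hy : y ∈ O <;> simp [hy]
  have hΦ : ∀ x, QuotientGroup.lift _ Ψ hΨ (QuotientGroup.mk' _ x) = Ψ x := fun _ => rfl
  refine ⟨QuotientGroup.lift _ Ψ hΨ, fun a g => ?_, fun y => ?_⟩
  · exact hΨv a g
  · by_cases hy : y ∈ O
    · rw [edgeElement, if_pos hy, letterClass, hΦ, hΨl]
      exact if_pos hy
    · rw [edgeElement, if_neg hy, letterClass, map_inv, hΦ, hΨl]
      simp [lt, hy, hbar]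

/-! ### Reduced words in the fundamental group -/

variable (𝒢 T O)

/-- `𝒢.IsWord T O a L b`: the entries `(y, g)` of `L` consist of the successive edges `y` of a path
from `a` to `b`, and of elements `g` of the groups of their termini. -/
def IsWord : V → List (E × 𝒢.FundamentalGroup T O) → V → Prop
  | a, [], b => a = b
  | a, x :: L, b => X.o x.1 = a ∧ x.2 ∈ (𝒢.vertexHom T O (X.t x.1)).range ∧ IsWord (X.t x.1) L b

/-- The product of the elements of the fundamental group given by a word. -/
noncomputable def wordProd (L : List (E × 𝒢.FundamentalGroup T O)) : 𝒢.FundamentalGroup T O :=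
  (L.map fun x => 𝒢.edgeElement T O x.1 * x.2).prod

/-- A word is reduced if it contains no `y, g, bar y` with `g` in the edge group of `y`. -/
def IsReducedWord (L : List (E × 𝒢.FundamentalGroup T O)) : Prop :=
  L.IsChain fun x z => z.1 = X.bar x.1 →
    x.2 ∉ ((𝒢.vertexHom T O (X.t x.1)).comp (𝒢.f x.1)).range

variable {𝒢 T O}

theorem wordProd_cons (x : E × 𝒢.FundamentalGroup T O) (L) :
    𝒢.wordProd T O (x :: L) = 𝒢.edgeElement T O x.1 * x.2 * 𝒢.wordProd T O L := by
  rw [wordProd, wordProd, List.map_cons, List.prod_cons]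

theorem exists_isWord (hT : T.IsMaximalSubtree) (hO : X.IsOrientation O) (b : V)
    (x : 𝒢.FundamentalGroup T O) : ∃ g ∈ (𝒢.vertexHom T O b).range, ∃ L, 𝒢.IsWord T O b L b ∧
      x = g * 𝒢.wordProd T O L := by
  -- the elements represented by words from `a` to `b`
  let W : V → Set (𝒢.FundamentalGroup T O) := fun a => {x | ∃ g ∈ (𝒢.vertexHom T O a).range,
    ∃ L, 𝒢.IsWord T O a L b ∧ x = g * 𝒢.wordProd T O L}
  have hvert : ∀ a h x, x ∈ W a → 𝒢.vertexHom T O a h * x ∈ W a := by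
    rintro a h _ ⟨g, hg, L, hL, rfl⟩
    exact ⟨_, mul_mem ⟨h, rfl⟩ hg, L, hL, (mul_assoc _ _ _).symm⟩
  have hedge : ∀ y x, x ∈ W (X.t y) → 𝒢.edgeElement T O y * x ∈ W (X.o y) := by
    rintro y _ ⟨g, hg, L, hL, rfl⟩
    refine ⟨1, one_mem _, (y, g) :: L, ⟨rfl, hg, hL⟩, ?_⟩
    rw [wordProd_cons, one_mul, mul_assoc]
  have hpath : ∀ (l : List E), (∀ y ∈ l, y ∈ T.edges) → ∀ a c x, X.IsPath a l c →
      x ∈ W c → x ∈ W a := by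
    intro l
    induction l with
    | nil => rintro - a c x rfl hx; exact hx
    | cons y l ih =>
      rintro hl a c x ⟨rfl, hp⟩ hx
      have := hedge y x (ih (fun z hz => hl z (by simp [hz])) _ _ _ hp hx)
      rwa [edgeElement_of_mem_edges (hl y (by simp)), one_mul] at this
  have hmove : ∀ a c x, x ∈ W c → x ∈ W a := by
    intro a c x hx
    have huniv := hT.verts_eq_univ 𝒢.connected
    obtain ⟨l, hl, hp⟩ := hT.1.connected a (huniv ▸ Set.mem_univ a) c (huniv ▸ Set.mem_univ c)
    exact hpath l hl a c x hp hx
  -- the elements that preserve `W b` under left multiplication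
  let S : Subgroup (𝒢.FundamentalGroup T O) :=
    { carrier := {s | (∀ x ∈ W b, s * x ∈ W b) ∧ ∀ x ∈ W b, s⁻¹ * x ∈ W b}
      one_mem' := by simp
      mul_mem' := by
        rintro s t ⟨hs, hs'⟩ ⟨ht, ht'⟩
        refine ⟨fun x hx => ?_, fun x hx => ?_⟩
        · rw [mul_assoc]; exact hs _ (ht x hx)
        · rw [mul_inv_rev, mul_assoc]; exact ht' _ (hs' x hx)
      inv_mem' := by
        rintro s ⟨hs, hs'⟩
        exact ⟨hs', by simpa using hs⟩ }
  have hvS : ∀ a g, 𝒢.vertexHom T O a g ∈ S := by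
    refine fun a g => ⟨fun x hx => ?_, fun x hx => ?_⟩
    · exact hmove _ a _ (hvert a g x (hmove a b x hx))
    · rw [← map_inv]
      exact hmove _ a _ (hvert a g⁻¹ x (hmove a b x hx))
  have heS : ∀ y, 𝒢.edgeElement T O y ∈ S := by
    refine fun y => ⟨fun x hx => hmove _ _ _ (hedge y x (hmove _ b x hx)), fun x hx => ?_⟩
    rw [← edgeElement_bar hO]
    exact hmove _ _ _ (hedge _ x (hmove _ b x hx))
  have h₁ : (1 : 𝒢.FundamentalGroup T O) ∈ W b := ⟨1, one_mem _, [], rfl, by simp [wordProd]⟩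
  have := (fundamentalGroup_induction hvS heS x).1 1 h₁
  rwa [mul_one] at this

theorem exists_shorter_word (hO : X.IsOrientation O) {a b : V} {g : 𝒢.FundamentalGroup T O}
    (hg : g ∈ (𝒢.vertexHom T O a).range) {L : List (E × 𝒢.FundamentalGroup T O)}
    (hL : 𝒢.IsWord T O a L b) (hr : ¬ 𝒢.IsReducedWord T O L) :
    ∃ g' ∈ (𝒢.vertexHom T O a).range, ∃ L', 𝒢.IsWord T O a L' b ∧ L'.length < L.length ∧
      g * 𝒢.wordProd T O L = g' * 𝒢.wordProd T O L' := by
  induction L generalizing a g with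
  | nil => exact absurd List.isChain_nil hr
  | cons x L ih =>
    obtain ⟨y, h⟩ := x
    obtain ⟨rfl, hh, hL⟩ := hL
    by_cases htail : 𝒢.IsReducedWord T O L
    · cases L with
      | nil => exact absurd (List.isChain_singleton _) hr
      | cons z L =>
        obtain ⟨z, k⟩ := z
        obtain ⟨hz, hk, hL⟩ := hL
        have hyz : ¬ (z = X.bar y → h ∉ ((𝒢.vertexHom T O (X.t y)).comp (𝒢.f y)).range) :=
          fun hyz => hr (List.isChain_cons_cons.2 ⟨hyz, htail⟩)
        push Not at hyz
        obtain ⟨rfl, γ, rfl⟩ := hyz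
        have hconj := edgeElement_mul_vertexHom (T := T) hO y rfl (X.geom_bar y) γ
        dsimp only at hk hL
        rw [X.t_bar] at hk hL
        refine ⟨g * (𝒢.vertexHom T O _ (𝒢.edgeMap (X.bar y) (X.geom_bar y) γ) * k),
          mul_mem hg (mul_mem ?_ hk), L, hL, by simp, ?_⟩
        · rw [← X.t_bar y]
          exact ⟨_, rfl⟩
        · rw [wordProd_cons, wordProd_cons, ← hconj, edgeElement_bar hO]
          simp only [edgeMap_rfl, MonoidHom.comp_apply, mul_assoc]
    · obtain ⟨g', hg', L', hL', hlen, heq⟩ := ih hh hL htail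
      refine ⟨g, hg, (y, g') :: L', ⟨rfl, hg', hL'⟩, by simpa using hlen, ?_⟩
      rw [wordProd_cons, wordProd_cons]
      simp only [mul_assoc]
      rw [heq]

theorem exists_isReducedWord (hT : T.IsMaximalSubtree) (hO : X.IsOrientation O) (b : V)
    (x : 𝒢.FundamentalGroup T O) : ∃ g ∈ (𝒢.vertexHom T O b).range, ∃ L, 𝒢.IsWord T O b L b ∧
      𝒢.IsReducedWord T O L ∧ x = g * 𝒢.wordProd T O L := by
  obtain ⟨g, hg, L, hL, rfl⟩ := exists_isWord hT hO b x
  induction hn : L.length using Nat.strong_induction_on generalizing g L with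
  | _ n ih =>
    by_cases hr : 𝒢.IsReducedWord T O L
    · exact ⟨g, hg, L, hL, hr, rfl⟩
    obtain ⟨g', hg', L', hL', hlen, heq⟩ := exists_shorter_word hO hg hL hr
    rw [heq]
    exact ih L'.length (hn ▸ hlen) g' hg' L' hL' rfl

end GraphOfGroups

/-! ### Homomorphisms to finite `p`-groups -/

theorem exists_normal_of_hom {p : ℕ} [Fact p.Prime] {G : Type*} [Group G] {K : Type*} [Group K]
    [Finite K] (hK : IsPGroup p K) (θ : G →* K) {g : G} (hg : θ g ≠ 1) :
    ∃ N : Subgroup G, N.Normal ∧ (∃ n : ℕ, N.index = p ^ n) ∧ g ∉ N := by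
  refine ⟨θ.ker, inferInstance, ?_, hg⟩
  rw [Subgroup.index_ker]
  exact IsPGroup.iff_card.1 (hK.to_subgroup θ.range)

namespace GraphOfGroups

variable {V : Type u} {E : Type v} {X : SerreGraph V E} {𝒢 : GraphOfGroups.{u, v, w, w'} X}
  {p : ℕ} {T : X.Sub} {O : Set E} {Cv : ∀ a, ChiefSeries p (𝒢.vertexGroup a)} {n : ℕ}

namespace CompatibleActions

theorem τ_injective (S : CompatibleActions Cv n) {a : V} (ha : (Cv a).term n = ⊥) :
    Function.Injective (S.τ a) := by
  rw [injective_iff_map_eq_one]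
  intro g hg
  obtain ⟨w⟩ := S.nonempty
  have := (S.smul_eq_iff a g w).1 (by rw [hg, one_smul])
  rwa [ha, Subgroup.mem_bot] at this

/-- The image of an edge group in `P`. -/
def edgeRange (S : CompatibleActions Cv n) (y : E) : Subgroup S.P :=
  ((S.τ (X.t y)).comp (𝒢.f y)).range

theorem τ_edgeMap_mem (S : CompatibleActions Cv n) {e : X.GeomEdge} (y : E) (h : X.geom y = e)
    (g : 𝒢.edgeGroup e) : S.τ _ (𝒢.edgeMap y h g) ∈ S.edgeRange y := by
  subst h; exact ⟨g, rfl⟩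

/-- The conjugating elements of opposite edges can be chosen to be inverse to each other. -/
theorem exists_conj_bar (S : CompatibleActions Cv n) (hO : X.IsOrientation O) :
    ∃ c : E → S.P, (∀ y, c (X.bar y) = (c y)⁻¹) ∧ ∀ (y : E) (g : 𝒢.edgeGroup (X.geom y)),
      c y * S.τ _ (𝒢.f y g) * (c y)⁻¹ = S.τ _ (𝒢.edgeMap (X.bar y) (X.geom_bar y) g) := by
  classical
  choose c₀ hc₀ using fun y => S.conj _ y (X.bar y) rfl (X.geom_bar y)
  have hc₁ : ∀ (y : E) (e : X.GeomEdge) (h : X.geom y = e) (h' : X.geom (X.bar y) = e) g,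
      c₀ y * S.τ _ (𝒢.edgeMap y h g) * (c₀ y)⁻¹ = S.τ _ (𝒢.edgeMap (X.bar y) h' g) := by
    rintro y e rfl h' g
    exact hc₀ y g
  have hbar : ∀ (y z : E) (e : X.GeomEdge) (h : X.geom y = e) (h' : X.geom z = e) (_ : y = z) g,
      S.τ _ (𝒢.edgeMap y h g) = S.τ _ (𝒢.edgeMap z h' g) := by
    rintro y z e h h' rfl g
    rfl
  refine ⟨fun y => if y ∈ O then c₀ y else (c₀ (X.bar y))⁻¹, fun y => ?_, fun y g => ?_⟩
  · have := hO.bar_mem_iff y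
    by_cases hy : y ∈ O
    · simp only [this, hy, not_true_eq_false, if_false, if_true, X.bar_bar]
    · simp only [this, hy, not_false_eq_true, if_false, if_true, inv_inv]
  · by_cases hy : y ∈ O
    · simp only [if_pos hy]
      exact hc₀ y g
    · simp only [if_neg hy, inv_inv]
      have h := (X.geom_bar (X.bar y)).trans (X.geom_bar y)
      have h₁ := hc₁ (X.bar y) (X.geom y) (X.geom_bar y) h g
      rw [hbar _ y _ h rfl (X.bar_bar y)] at h₁
      rw [← edgeMap_rfl, ← h₁]
      group

end CompatibleActions

/-- A reduced word in the fundamental group gives rise to a word without backtracking over `P`,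
provided that the vertex groups which it meets embed into `P`. -/
theorem exists_word_without_backtrack (S : CompatibleActions Cv n) {Q : Type*} [Group Q]
    {C : E → Q} {f : V → Q} {κ : S.P →* Q} {Φ : 𝒢.FundamentalGroup T O →* Q}
    (hΦv : ∀ a g, Φ (𝒢.vertexHom T O a g) = f a * κ (S.τ a g) * (f a)⁻¹)
    (hΦe : ∀ y, Φ (𝒢.edgeElement T O y) = f (X.o y) * C y * (f (X.t y))⁻¹)
    {L : List (E × 𝒢.FundamentalGroup T O)} {a b : V} (hL : 𝒢.IsWord T O a L b)
    (hr : 𝒢.IsReducedWord T O L) (hn : ∀ x ∈ L, (Cv (X.t x.1)).term n = ⊥) :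
    ∃ M : List (E × S.P), M.map Prod.fst = L.map Prod.fst ∧
      M.IsChain (fun x z => z.1 = X.bar x.1 → x.2 ∉ S.edgeRange x.1) ∧
      Φ (𝒢.wordProd T O L) = f a * (M.map fun x => C x.1 * κ x.2).prod * (f b)⁻¹ := by
  induction L generalizing a with
  | nil =>
    obtain rfl : a = b := hL
    exact ⟨[], rfl, List.isChain_nil, by simp [wordProd]⟩
  | cons x L ih =>
    obtain ⟨y, g⟩ := x
    obtain ⟨rfl, hg, hL⟩ := hL
    obtain ⟨h, rfl⟩ : g ∈ (𝒢.vertexHom T O (X.t y)).range := hg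
    obtain ⟨M, hML, hM, hprod⟩ := ih hL (List.IsChain.tail hr) fun x hx => hn x (by simp [hx])
    refine ⟨(y, S.τ _ h) :: M, by simp [hML], ?_, ?_⟩
    · cases M with
      | nil => exact List.isChain_singleton _
      | cons z M =>
        refine List.isChain_cons_cons.2 ⟨?_, hM⟩
        rintro hz ⟨k, hk⟩
        cases L with
        | nil => simp at hML
        | cons z' L =>
          refine (List.isChain_cons_cons.1 hr).1 ?_ ⟨k, ?_⟩
          · rw [List.map_cons, List.map_cons] at hML
            rw [← (List.cons.inj hML).1]
            exact hz
          · have := S.τ_injective (hn _ List.mem_cons_self) hk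
            exact congrArg (𝒢.vertexHom T O (X.t y)) this
    · rw [wordProd_cons, map_mul, map_mul, hprod, hΦv, hΦe, List.map_cons, List.prod_cons]
      group

/-- The generic homomorphism: each conjugating element is perturbed by free letters. -/
theorem exists_generic_hom (S : CompatibleActions Cv n) (hT : T.IsTree) (hO : X.IsOrientation O) :
    ∃ (c : E → S.P) (f : V → GenericGroup E S.P)
      (Φ : 𝒢.FundamentalGroup T O →* GenericGroup E S.P),
      (∀ a g, Φ (𝒢.vertexHom T O a g) =
        f a * SemidirectProduct.inr (S.τ a g) * (f a)⁻¹) ∧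
      ∀ y, Φ (𝒢.edgeElement T O y) =
        f (X.o y) * X.conjugator S.edgeRange c y * (f (X.t y))⁻¹ := by
  obtain ⟨c, hc, hconj⟩ := S.exists_conj_bar hO
  have hbar := X.conjugator_bar S.edgeRange hc
  obtain ⟨f, hf⟩ := hT.exists_potential hbar
  refine ⟨c, f, exists_fundamentalGroup_hom hO
    (fun a => (MulAut.conj (f a)).toMonoidHom.comp (SemidirectProduct.inr.comp (S.τ a)))
    (fun y => f (X.o y) * X.conjugator S.edgeRange c y * (f (X.t y))⁻¹)
    (fun y => ?_) (fun y hy => ?_) fun y g => ?_⟩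
  · rw [hbar, X.o_bar, X.t_bar]; group
  · rw [hf y hy, mul_inv_cancel]
  · have h := X.conjugator_mul_inr S.edgeRange c (S.τ_edgeMap_mem y rfl g)
      (S.τ_edgeMap_mem (X.bar y) (X.geom_bar y) g) (hconj y g)
    have hft : f (X.t (X.bar y)) = f (X.o y) := by rw [X.t_bar]
    simp only [MonoidHom.comp_apply, MulEquiv.coe_toMonoidHom, MulAut.conj_apply]
    rw [hft, ← h, edgeMap_rfl]
    group

end GraphOfGroups

theorem ChiefSeries.exists_forall_mem_term_eq_bot {p : ℕ} {I : Type*} {G : I → Type*}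
    [∀ i, Group (G i)] (C : ∀ i, ChiefSeries p (G i)) (l : List I) :
    ∃ n, ∀ i ∈ l, (C i).term n = ⊥ := by
  induction l with
  | nil => exact ⟨0, by simp⟩
  | cons i l ih =>
    obtain ⟨n, hn⟩ := ih
    obtain ⟨m, hm⟩ := (C i).exists_eq_bot
    refine ⟨max m n, fun j hj => ?_⟩
    rcases List.mem_cons.1 hj with rfl | hj
    · exact eq_bot_iff.2 (hm ▸ (C j).term_antitone (le_max_left m n))
    · exact eq_bot_iff.2 (hn j hj ▸ (C j).term_antitone (le_max_right m n))

theorem theorem1 (p : ℕ) (hp : p.Prime) {V : Type u} {E : Type v} (X : SerreGraph V E)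
    (𝒢 : GraphOfGroups.{u, v, w, w'} X)
    (hv : ∀ a, Finite (𝒢.vertexGroup a) ∧ IsPGroup p (𝒢.vertexGroup a))
    (he : ∀ e, Finite (𝒢.edgeGroup e) ∧ IsPGroup p (𝒢.edgeGroup e))
    (T : X.Sub) (hT : T.IsMaximalSubtree)
    (P : Set E) (hP : X.IsOrientation P)
    (Cv : ∀ a, ChiefSeries p (𝒢.vertexGroup a))
    (Ce : ∀ e, ChiefSeries p (𝒢.edgeGroup e))
    (hI : 𝒢.SeriesCompatible Cv Ce)
    (hII : GraphOfGroups.FactorsCompatible hI) :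
    ResiduallyPFinite p (𝒢.FundamentalGroup T P) := by
  have : Fact p.Prime := ⟨hp⟩
  intro x hx
  obtain ⟨b⟩ := 𝒢.connected.1
  obtain ⟨_, ⟨h, rfl⟩, L, hL, hr, rfl⟩ := GraphOfGroups.exists_isReducedWord hT hP b x
  obtain ⟨n, hn⟩ := ChiefSeries.exists_forall_mem_term_eq_bot Cv (b :: L.map fun x => X.t x.1)
  obtain ⟨S⟩ := hII.nonempty_compatibleActions (fun a => (hv a).2) n
  obtain ⟨c, f, Φ, hΦv, hΦe⟩ := GraphOfGroups.exists_generic_hom S hT.1 hP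
  obtain ⟨M, hML, hM, hprod⟩ := GraphOfGroups.exists_word_without_backtrack S hΦv hΦe hL hr
    fun x hx => hn _ (List.mem_cons_of_mem _ (List.mem_map_of_mem hx))
  have hΦ : Φ (𝒢.vertexHom T P b h * 𝒢.wordProd T P L) = f b *
      (SemidirectProduct.inr (S.τ b h) * (M.map fun x =>
        X.conjugator S.edgeRange c x.1 * SemidirectProduct.inr x.2).prod) * (f b)⁻¹ := by
    rw [map_mul, hΦv, hprod]; group
  have hK : ∃ (K : Type) (_ : Group K) (_ : Finite K) (ψ : GenericGroup E S.P →* K),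
      IsPGroup p K ∧ ψ (SemidirectProduct.inr (S.τ b h) * (M.map fun x =>
        X.conjugator S.edgeRange c x.1 * SemidirectProduct.inr x.2).prod) ≠ 1 := by
    by_cases hMne : M = []
    · -- the element lies in the group of the vertex `b`, which embeds into the finite group
      subst hMne
      obtain rfl : L = [] := List.map_eq_nil_iff.1 hML.symm
      refine ⟨S.P, inferInstance, inferInstance, SemidirectProduct.rightHom, S.isPGroup,
        fun h₁ => hx ?_⟩
      have h₂ : S.τ b h = 1 := by simpa using h₁
      rw [(map_eq_one_iff _ (S.τ_injective (hn b List.mem_cons_self))).1 h₂]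
      simp [GraphOfGroups.wordProd]
    · exact X.exists_isPGroup_of_no_backtrack c S.isPGroup _ M hMne hM
  obtain ⟨K, _, _, ψ, hKp, hψ⟩ := hK
  refine exists_normal_of_hom hKp (ψ.comp Φ) fun h₁ => hψ ?_
  rw [MonoidHom.comp_apply, hΦ, map_mul, map_mul, map_inv] at h₁
  exact conj_eq_one_iff.1 h₁
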